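/- Let $b\ge 2$ be an integer, $\mathbb K$ a field of characteristic zero, $\overline{\mathbb K}$ an algebraic closure of $\mathbb K$, and $\mathbb L$ a field with $\mathbb K\subseteq\mathbb L\subseteq\overline{\mathbb K}$. For a field $E$ let $E((x^{1/q}))$ be the field of Laurent series in $x^{1/q}$, let $\mathrm{Puiseux}(E)=\bigcup_{q\ge1}E((x^{1/q}))$, and let $M$ be the Mahler operator $f(x)\mapsto f(x^b)$. Let $D_E$ be the $\mathrm{Puiseux}(E)$-algebra with basis $(e_\lambda)_{\lambda\in E\setminus\{0\}}$ and relations $e_\lambda e_\mu=e_{\lambda\mu}$, $e_1=1$; extend $M$ to a ring endomorphism of $D_E$ by $Me_\lambda=\lambda e_\lambda$. An element $y\in D_E$ is hypergeometric if $My=uy$ for some $u\in\mathrm{Puiseux}(E)$. Let $r\in\mathbb N$ and $\ell_0,\dots,\ell_r\in\mathbb K[x]$ with $\ell_0\ne0$ and $\ell_r\neq0$. Consider the linear operator $L=\sum_{k=0}^r\ell_kM^k$ and the Riccati Mahler equation $$\ell_r\,u\,Mu\cdots M^{r-1}u+\dots+\ell_2\,u\,Mu+\ell_1u+\ell_0=0.\tag{R}$$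 Write $\ell_k=\sum_j\ell_{k,j}x^j$. The lower Newton polygon of $L$ is the lower convex hull of the points $(b^k,j)$ with $\ell_{k,j}\ne0$. The characteristic polynomial of an edge whose left end point has abscissa $b^{k_1}$ is $\chi(X)=\sum\ell_{k,j}X^{k-k_1}$, summed over the points $(b^k,j)$ on the edge; the edge is $\lambda$-admissible if $\chi(\lambda)=0$. Let $\Lambda\subset\overline{\mathbb K}$ be the set of all roots of the characteristic polynomials of the edges, and let $q_\lambda$ be the lcm of those denominators of slopes of $\lambda$-admissible edges that are coprime with $b$. Let $\Lambda'$ be the set of $\lambda\in\Lambda$ such that $Ly=0$ has a nonzero solution $y\in e_\lambda\,\mathrm{Puiseux}(\overline{\mathbb K})$. For $\lambda\in\mathbb L\cap\Lambda'$ let $\mathfrak H_{\mathbb L,\lambda}$ be the $\mathbb L$-vector space of the hypergeometric solutions of $Ly=0$ in $e_\lambda\,\mathrm{Puiseux}(\mathbb L)\subseteq D_{\mathbb L}$, and let $\mathfrak R_{\mathbb L,\lambda}\subseteq\mathrm{Puiseux}(\mathbb L)$ be the image of $\mathfrak H_{\mathbb L,\lambda}\setminus\{0\}$ under $y\mapsto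 My/y$. **Theorem.** The set $\mathbb L\cap\Lambda'$ is finite, and the set of solutions $u\in\mathrm{Puiseux}(\mathbb L)$ of (R) is the disjoint union $$\coprod_{\lambda\in\mathbb L\cap\Lambda'}\mathfrak R_{\mathbb L,\lambda}.$$ For each $\lambda\in\mathbb L\cap\Lambda'$: * every element of $\mathfrak R_{\mathbb L,\lambda}$ lies in $\mathbb L((x^{1/q_\lambda}))$ and has leading coefficient $\lambda$; * $\mathfrak H_{\mathbb L,\lambda}$ is nonzero and finite-dimensional over $\mathbb L$, every nonzero element of it is invertible in $D_{\mathbb L}$, and $y\mapsto My/y$ induces a bijection from the projective space $\mathbb P(\mathfrak H_{\mathbb L,\lambda})$ onto $\mathfrak R_{\mathbb L,\lambda}$. This bijection is rational: in the homogeneous coordinates given by any $\mathbb L$-basis of $\mathfrak H_{\mathbb L,\lambda}$, it is a quotient of two homogeneous polynomials of the same degree with coefficients in $\mathrm{Puiseux}(\mathbb L)$, the denominator having no zero on $\mathbb P(\mathfrak H_{\mathbb L,\lambda})$. Moreover, $$\sum_{\lambda\in\mathbb L\cap\Lambda'}\dim\mathbb P(\mathfrak H_{\mathbb L,\lambda})\;\le\;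 r-\#(\mathbb L\cap\Lambda'),\qquad\text{where }\dim\mathbb P(\mathfrak H_{\mathbb L,\lambda})=\dim_{\mathbb L}\mathfrak H_{\mathbb L,\lambda}-1.$$ -/

import Mathlib

noncomputable section

namespace MahlerRiccati

open HahnSeries Polynomial

/-! ### Puiseux series and the Mahler operator on them

`HahnSeries ℚ E` consists of the formal series in `x` with coefficients in `E` and rational
exponents with well-ordered support. -/

/-- The coefficientwise algebra structure is the one used throughout. -/
instance (priority := 2000) hahnAlgebra (Γ E : Type*) [AddCommGroup Γ] [LinearOrder Γ]
    [IsOrderedAddMonoid Γ] [Field E] : Algebra E (HahnSeries Γ E) :=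
  HahnSeries.instAlgebra

/-- Embedding of Laurent series into series with rational exponents that sends `x` to
`x ^ (1 / q)`. -/
def laurentRoot (E : Type*) [Field E] (q : ℕ) (hq : 0 < q) :
    HahnSeries ℤ E →ₐ[E] HahnSeries ℚ E :=
  embDomainAlgHom
    ({ toFun := fun n => (n : ℚ) / q
       map_zero' := by simp
       map_add' := fun m n => by push_cast; ring } : ℤ →+ ℚ)
    (fun m n h => by
      have hq' : (q : ℚ) ≠ 0 := by positivity
      have h' : (m : ℚ) / q = (n : ℚ) / q := h
      exact_mod_cast (div_left_inj' hq').1 h')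
    (fun m n => by
      have hq' : (0 : ℚ) < q := by positivity
      change (m : ℚ) / q ≤ (n : ℚ) / q ↔ m ≤ n
      rw [div_le_div_iff_of_pos_right hq']
      exact_mod_cast Iff.rfl)

/-- The field `E((x^{1/q}))` for `q ≥ 1`, inside the series with rational exponents. -/
def ramifiedLaurent (E : Type*) [Field E] (q : ℕ) (hq : 0 < q) :
    IntermediateField E (HahnSeries ℚ E) :=
  (laurentRoot E q hq).fieldRange

/-- A series with rational exponents lies in `E((x^{1/q}))` iff all its exponents
lie in `(1/q)ℤ`. -/
theorem mem_ramifiedLaurent_iff {E : Type*} [Field E] {q : ℕ} (hq : 0 < q)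
    (f : HahnSeries ℚ E) :
    f ∈ ramifiedLaurent E q hq ↔ ∀ a : ℚ, f.coeff a ≠ 0 → ∃ n : ℤ, a = (n : ℚ) / q := by
  have hq' : (0 : ℚ) < q := by positivity
  constructor
  · rintro ⟨g, rfl⟩ a ha
    by_contra hcon
    apply ha
    change (embDomain _ g).coeff a = 0
    apply embDomain_of_notMem_range
    rintro ⟨n, hn⟩
    exact hcon ⟨n, hn.symm⟩
  · intro h
    have hmono : Monotone (fun n : ℤ => (n : ℚ) / q) := by
      intro m n hmn
      have : (m : ℚ) ≤ n := by exact_mod_cast hmn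
      change (m : ℚ) / q ≤ (n : ℚ) / q
      gcongr
    have hinj : ∀ m n : ℤ, (m : ℚ) / q ≤ (n : ℚ) / q → m ≤ n := by
      intro m n hmn
      rw [div_le_div_iff_of_pos_right hq'] at hmn
      exact_mod_cast hmn
    let s : Set ℤ := {n : ℤ | f.coeff ((n : ℚ) / q) ≠ 0}
    have hs : s.IsPWO := by
      intro u
      obtain ⟨m, n, hmn, hle⟩ := f.isPWO_support
        (fun k => ⟨((u k : ℤ) : ℚ) / q, (u k).2⟩)
      exact ⟨m, n, hmn, hinj _ _ hle⟩
    refine ⟨⟨fun n : ℤ => f.coeff ((n : ℚ) / q), hs⟩, ?_⟩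
    ext a
    by_cases ha : ∃ n : ℤ, a = (n : ℚ) / q
    · obtain ⟨n, rfl⟩ := ha
      exact embDomain_coeff (a := n)
    · have h0 : f.coeff a = 0 := by
        by_contra hne
        exact ha (h a hne)
      rw [h0]
      change (embDomain _ _).coeff a = 0
      apply embDomain_of_notMem_range
      rintro ⟨n, hn⟩
      exact ha ⟨n, hn.symm⟩

theorem ramifiedLaurent_le {E : Type*} [Field E] {q q' : ℕ} (hq : 0 < q) (hq' : 0 < q')
    (hd : q ∣ q') : ramifiedLaurent E q hq ≤ ramifiedLaurent E q' hq' := by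
  intro f hf
  rw [mem_ramifiedLaurent_iff] at hf ⊢
  obtain ⟨c, rfl⟩ := hd
  have hc : 0 < c := Nat.pos_of_mul_pos_left hq'
  intro a ha
  obtain ⟨n, rfl⟩ := hf a ha
  refine ⟨n * c, ?_⟩
  have h1 : (q : ℚ) ≠ 0 := by positivity
  have h2 : (c : ℚ) ≠ 0 := by positivity
  push_cast
  field_simp

/-- The field of Puiseux series over `E`, the union of the fields `E((x^{1/q}))`, `q ≥ 1`. -/
def puiseuxField (E : Type*) [Field E] : IntermediateField E (HahnSeries ℚ E) where
  carrier := {f | ∃ (q : ℕ) (hq : 0 < q), f ∈ ramifiedLaurent E q hq}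
  mul_mem' := by
    rintro f g ⟨q, hq, hf⟩ ⟨q', hq', hg⟩
    exact ⟨q * q', Nat.mul_pos hq hq', mul_mem
      (ramifiedLaurent_le hq _ (Dvd.intro _ rfl) hf)
      (ramifiedLaurent_le hq' _ (Dvd.intro_left _ rfl) hg)⟩
  add_mem' := by
    rintro f g ⟨q, hq, hf⟩ ⟨q', hq', hg⟩
    exact ⟨q * q', Nat.mul_pos hq hq', add_mem
      (ramifiedLaurent_le hq _ (Dvd.intro _ rfl) hf)
      (ramifiedLaurent_le hq' _ (Dvd.intro_left _ rfl) hg)⟩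
  algebraMap_mem' := fun c => ⟨1, Nat.one_pos, IntermediateField.algebraMap_mem _ c⟩
  inv_mem' := by
    rintro f ⟨q, hq, hf⟩
    exact ⟨q, hq, inv_mem hf⟩

abbrev Puiseux (E : Type*) [Field E] : Type _ := ↥(puiseuxField E)

/-- The substitution `f(x) ↦ f(x^b)` on series with rational exponents. -/
def mahlerHahn (b : ℕ) [b.AtLeastTwo] (E : Type*) [Field E] :
    HahnSeries ℚ E →ₐ[E] HahnSeries ℚ E :=
  have hb : (0 : ℚ) < b := by
    have := Nat.AtLeastTwo.prop (n := b)
    exact_mod_cast (by omega : 0 < b)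
  embDomainAlgHom
    ({ toFun := fun a => (b : ℚ) * a
       map_zero' := by simp
       map_add' := fun _ _ => by ring } : ℚ →+ ℚ)
    (fun _ _ h => mul_left_cancel₀ hb.ne' h)
    (fun _ _ => mul_le_mul_iff_right₀ hb)

theorem mahlerHahn_mem (b : ℕ) [b.AtLeastTwo] {E : Type*} [Field E] {f : HahnSeries ℚ E}
    (hf : f ∈ puiseuxField E) : mahlerHahn b E f ∈ puiseuxField E := by
  obtain ⟨q, hq, hf⟩ := hf
  refine ⟨q, hq, ?_⟩
  rw [mem_ramifiedLaurent_iff] at hf ⊢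
  intro a ha
  by_cases h : ∃ c : ℚ, (b : ℚ) * c = a
  · obtain ⟨c, rfl⟩ := h
    have hc : (mahlerHahn b E f).coeff ((b : ℚ) * c) = f.coeff c := embDomain_coeff (a := c)
    rw [hc] at ha
    obtain ⟨n, rfl⟩ := hf c ha
    exact ⟨b * n, by push_cast; ring⟩
  · exfalso
    apply ha
    change (embDomain _ f).coeff a = 0
    apply embDomain_of_notMem_range
    rintro ⟨c, hc⟩
    exact h ⟨c, hc⟩

/-- The Mahler operator `M` of radix `b` on Puiseux series. -/
def mahler (b : ℕ) [b.AtLeastTwo] (E : Type*) [Field E] : Puiseux E →ₐ[E] Puiseux E :=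
  ((mahlerHahn b E).comp (puiseuxField E).val).codRestrict (puiseuxField E).toSubalgebra
    (fun f => mahlerHahn_mem b f.2)

/-- The Puiseux series `x`. -/
def puiseuxX (E : Type*) [Field E] : Puiseux E :=
  ⟨single (1 : ℚ) (1 : E), by
    refine ⟨1, Nat.one_pos, ?_⟩
    rw [mem_ramifiedLaurent_iff]
    intro a ha
    refine ⟨1, ?_⟩
    by_contra hne
    apply ha
    apply coeff_single_of_ne
    intro h
    apply hne
    rw [h]
    norm_num⟩

/-- A polynomial over `K` seen as a Puiseux series over an extension `E` of `K`. -/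
def polyToPuiseux (K E : Type*) [Field K] [Field E] [Algebra K E] : K[X] →+* Puiseux E :=
  eval₂RingHom ((algebraMap E (Puiseux E)).comp (algebraMap K E)) (puiseuxX E)

/-! ### The difference ring of generalized series -/

/-- The `Puiseux E`-algebra with basis `e_λ` (`λ` a nonzero element of `E`) and product
`e_λ e_μ = e_{λμ}`, `e_1 = 1`: the group algebra of `Eˣ`. -/
abbrev GenSeries (E : Type*) [Field E] : Type _ := MonoidAlgebra (Puiseux E) Eˣ

/-- The element `e_λ p`. -/
abbrev expTimes {E : Type*} [Field E] (lam : Eˣ) (p : Puiseux E) : GenSeries E :=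
  MonoidAlgebra.single lam p

/-- The Mahler operator on generalized series: it extends the one on Puiseux series and
satisfies `M e_λ = λ e_λ`. -/
def mahlerD (b : ℕ) [b.AtLeastTwo] (E : Type*) [Field E] : GenSeries E →ₐ[E] GenSeries E :=
  MonoidAlgebra.liftNCAlgHom
    ((IsScalarTower.toAlgHom E (Puiseux E) (GenSeries E)).comp (mahler b E))
    ({ toFun := fun lam => expTimes lam (algebraMap E (Puiseux E) lam)
       map_one' := by simp [MonoidAlgebra.one_def]
       map_mul' := fun lam mu => by simp [MonoidAlgebra.single_mul_single] } : Eˣ →* GenSeries E)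
    (fun _ _ => Commute.all _ _)

theorem mahlerD_expTimes (b : ℕ) [b.AtLeastTwo] {E : Type*} [Field E] (lam : Eˣ)
    (p : Puiseux E) :
    mahlerD b E (expTimes lam p) = expTimes lam ((lam : E) • mahler b E p) := by
  simp [mahlerD, MonoidAlgebra.liftNC_single, MonoidAlgebra.single_mul_single,
    Algebra.smul_def, mul_comm]

/-! ### The linear equation and the Riccati equation -/

/-- `L y` for the operator `L = ∑_{k ≤ r} ℓ_k M^k`. -/
def linOp (b : ℕ) [b.AtLeastTwo] {K : Type*} [Field K] {r : ℕ} (l : Fin (r + 1) → K[X])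
    {E : Type*} [Field E] [Algebra K E] (y : GenSeries E) : GenSeries E :=
  ∑ k : Fin (r + 1), polyToPuiseux K E (l k) • (mahlerD b E)^[k] y

/-- The Puiseux series `u` over `E` with `∑_{k ≤ r} ℓ_k u (M u) ⋯ (M^{k-1} u) = 0`. -/
def riccatiSolutions (b : ℕ) [b.AtLeastTwo] {K : Type*} [Field K] {r : ℕ}
    (l : Fin (r + 1) → K[X]) (E : Type*) [Field E] [Algebra K E] : Set (Puiseux E) :=
  {u | ∑ k : Fin (r + 1),
    polyToPuiseux K E (l k) * ∏ i ∈ Finset.range k, (mahler b E)^[i] u = 0}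

/-- `y` is hypergeometric: `M y = u y` for some Puiseux series `u`. -/
def IsHypergeometric (b : ℕ) [b.AtLeastTwo] {E : Type*} [Field E] (y : GenSeries E) : Prop :=
  ∃ u : Puiseux E, mahlerD b E y = u • y

/-- `u = M y / y`. -/
def IsMahlerQuotient (b : ℕ) [b.AtLeastTwo] {E : Type*} [Field E] (u : Puiseux E)
    (y : GenSeries E) : Prop :=
  IsUnit y ∧ mahlerD b E y = u • y

theorem isHypergeometric_expTimes (b : ℕ) [b.AtLeastTwo] {E : Type*} [Field E] (lam : Eˣ)
    (p : Puiseux E) : IsHypergeometric b (expTimes lam p) := by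
  by_cases hp : p = 0
  · exact ⟨0, by simp [hp]⟩
  · refine ⟨((lam : E) • mahler b E p) / p, ?_⟩
    rw [mahlerD_expTimes, MonoidAlgebra.smul_single, smul_eq_mul, div_mul_cancel₀ _ hp]

/-- The `E`-vector space of the hypergeometric solutions of `L y = 0` that lie in
`e_λ Puiseux(E)`. -/
def hypSolutions (b : ℕ) [b.AtLeastTwo] {K : Type*} [Field K] {r : ℕ} (l : Fin (r + 1) → K[X])
    (E : Type*) [Field E] [Algebra K E] (lam : Eˣ) : Submodule E (GenSeries E) where
  carrier := {y | (∃ p : Puiseux E, y = expTimes lam p) ∧ IsHypergeometric b y ∧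
    linOp b l y = 0}
  zero_mem' := ⟨⟨0, by simp⟩, ⟨0, by simp⟩, by simp [linOp]⟩
  add_mem' := by
    rintro _ _ ⟨⟨p, rfl⟩, -, hp⟩ ⟨⟨q, rfl⟩, -, hq⟩
    have h : expTimes lam p + expTimes lam q = expTimes lam (p + q) :=
      (MonoidAlgebra.single_add lam p q).symm
    refine ⟨⟨p + q, h⟩, h ▸ isHypergeometric_expTimes b lam (p + q), ?_⟩
    simp only [linOp, iterate_map_add, smul_add, Finset.sum_add_distrib] at hp hq ⊢
    rw [hp, hq, add_zero]
  smul_mem' := by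
    rintro c _ ⟨⟨p, rfl⟩, -, hp⟩
    have h : c • expTimes lam p = expTimes lam (c • p) := MonoidAlgebra.smul_single c lam p
    refine ⟨⟨c • p, h⟩, h ▸ isHypergeometric_expTimes b lam (c • p), ?_⟩
    have hit : ∀ (n : ℕ) (y : GenSeries E),
        (mahlerD b E)^[n] (c • y) = c • (mahlerD b E)^[n] y := by
      intro n
      induction n with
      | zero => intro y; rfl
      | succ n ih => intro y; simp only [Function.iterate_succ_apply, map_smul, ih]
    have hs : linOp b l (c • expTimes lam p) = c • linOp b l (expTimes lam p) := by
      simp only [linOp, hit, Finset.smul_sum]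
      refine Finset.sum_congr rfl fun k _ => ?_
      rw [← algebraMap_smul (Puiseux E) c, ← algebraMap_smul (Puiseux E) c, smul_smul, smul_smul,
        mul_comm]
    rw [hs, hp, smul_zero]

/-- The set of the quotients `M y / y` for nonzero hypergeometric solutions `y` of `L y = 0` in
`e_λ Puiseux(E)`. -/
def riccatiClass (b : ℕ) [b.AtLeastTwo] {K : Type*} [Field K] {r : ℕ} (l : Fin (r + 1) → K[X])
    (E : Type*) [Field E] [Algebra K E] (lam : Eˣ) : Set (Puiseux E) :=
  {u | ∃ y ∈ hypSolutions b l E lam, y ≠ 0 ∧ IsMahlerQuotient b u y}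

/-! ### The lower Newton polygon -/

/-- The pairs `(k, j)` such that the coefficient of `x^j` in `ℓ_k` is nonzero; the corresponding
point of the plane is `(b^k, j)`. -/
def newtonPoints {K : Type*} [Field K] {r : ℕ} (l : Fin (r + 1) → K[X]) :
    Finset (Σ _ : Fin (r + 1), ℕ) :=
  Finset.univ.sigma fun k => (l k).support

/-- Slope of the line through the points of two index pairs. -/
def edgeSlope (b : ℕ) {r : ℕ} (P Q : Σ _ : Fin (r + 1), ℕ) : ℚ :=
  ((Q.2 : ℚ) - P.2) / ((b : ℚ) ^ (Q.1 : ℕ) - (b : ℚ) ^ (P.1 : ℕ))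

/-- Ordinate at abscissa `b^k` of the line through the points of `P` and `Q`. -/
def lineAt (b : ℕ) {r : ℕ} (P Q : Σ _ : Fin (r + 1), ℕ) (k : Fin (r + 1)) : ℚ :=
  P.2 + edgeSlope b P Q * ((b : ℚ) ^ (k : ℕ) - (b : ℚ) ^ (P.1 : ℕ))

/-- The edges of the lower convex hull of the points `(b^k, j)`, given by their left and right
end points `P`, `Q`: no point lies below the line `PQ`, and the points on this line have abscissae
between those of `P` and `Q`. -/
def lowerEdges (b : ℕ) {K : Type*} [Field K] {r : ℕ} (l : Fin (r + 1) → K[X]) :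
    Finset ((Σ _ : Fin (r + 1), ℕ) × (Σ _ : Fin (r + 1), ℕ)) :=
  open Classical in
  (newtonPoints l ×ˢ newtonPoints l).filter fun e =>
    e.1.1 < e.2.1 ∧ ∀ T ∈ newtonPoints l,
      lineAt b e.1 e.2 T.1 ≤ T.2 ∧
      (lineAt b e.1 e.2 T.1 = T.2 → e.1.1 ≤ T.1 ∧ T.1 ≤ e.2.1)

/-- The characteristic polynomial of an edge with left end point of abscissa `b^{k₁}`: the sum of
`ℓ_{k,j} X^{k - k₁}` over the points `(b^k, j)` on the edge. -/
def charPoly (b : ℕ) {K : Type*} [Field K] {r : ℕ} (l : Fin (r + 1) → K[X])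
    (e : (Σ _ : Fin (r + 1), ℕ) × (Σ _ : Fin (r + 1), ℕ)) : K[X] :=
  open Classical in
  ∑ T ∈ (newtonPoints l).filter
      (fun T => e.1.1 ≤ T.1 ∧ T.1 ≤ e.2.1 ∧ lineAt b e.1 e.2 T.1 = T.2),
    C ((l T.1).coeff T.2) * X ^ ((T.1 : ℕ) - (e.1.1 : ℕ))

/-- The edge `e` is `λ`-admissible. -/
def IsAdmissible (b : ℕ) {K : Type*} [Field K] {r : ℕ} (l : Fin (r + 1) → K[X])
    {E : Type*} [Field E] [Algebra K E] (lam : E)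
    (e : (Σ _ : Fin (r + 1), ℕ) × (Σ _ : Fin (r + 1), ℕ)) : Prop :=
  aeval lam (charPoly b l e) = 0

/-- The set `Λ` of the roots in `E` of the characteristic polynomials of the edges. -/
def charRoots (b : ℕ) {K : Type*} [Field K] {r : ℕ} (l : Fin (r + 1) → K[X])
    (E : Type*) [Field E] [Algebra K E] : Set E :=
  {lam | ∃ e ∈ lowerEdges b l, IsAdmissible b l lam e}

/-- The ramification bound `q_λ`: the lcm of those denominators of slopes of `λ`-admissible edges
that are coprime with `b`. -/
def ramBound (b : ℕ) {K : Type*} [Field K] {r : ℕ} (l : Fin (r + 1) → K[X])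
    {E : Type*} [Field E] [Algebra K E] (lam : E) : ℕ :=
  open Classical in
  ((lowerEdges b l).filter fun e =>
    IsAdmissible b l lam e ∧ Nat.Coprime b (edgeSlope b e.1 e.2).den).lcm
      fun e => (edgeSlope b e.1 e.2).den

theorem ramBound_pos (b : ℕ) {K : Type*} [Field K] {r : ℕ} (l : Fin (r + 1) → K[X])
    {E : Type*} [Field E] [Algebra K E] (lam : E) : 0 < ramBound b l lam := by
  classical
  rw [Nat.pos_iff_ne_zero, ramBound, Ne, Finset.lcm_eq_zero_iff]
  rintro ⟨e, -, he⟩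
  exact (edgeSlope b e.1 e.2).den_nz he

/-- The set `Λ'` of the (necessarily nonzero) `λ ∈ Λ` such that `L y = 0` has a nonzero
solution in `e_λ Puiseux(E)`; it is used with `E` an algebraic closure of `K`. -/
def charRoots' (b : ℕ) [b.AtLeastTwo] {K : Type*} [Field K] {r : ℕ} (l : Fin (r + 1) → K[X])
    (E : Type*) [Field E] [Algebra K E] : Set Eˣ :=
  {lam | (lam : E) ∈ charRoots b l E ∧
    ∃ p : Puiseux E, expTimes lam p ≠ 0 ∧ linOp b l (expTimes lam p) = 0}

/-- The intersection of `Λ'` with an intermediate field `F`. -/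
def charRootsIn (b : ℕ) [b.AtLeastTwo] {K : Type*} [Field K] {r : ℕ} (l : Fin (r + 1) → K[X])
    {Kbar : Type*} [Field Kbar] [Algebra K Kbar] (F : IntermediateField K Kbar) : Set (↥F)ˣ :=
  {lam | Units.map (algebraMap F Kbar : F →* Kbar) lam ∈ charRoots' b l Kbar}

/-! ### Rational maps on a projective space -/

/-- A map `φ` from the projectivization of an `E`-vector space `V` to an extension field `F`
of `E` is rational: in the homogeneous coordinates given by a basis of `V`, it is a quotient of two
homogeneous polynomials of the same degree with coefficients in `F`, the denominator having no zero
on the projectivization. -/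
def IsRationalOnProj {E V F : Type*} [Field E] [AddCommGroup V] [Module E V] [Field F]
    [Algebra E F] (φ : Projectivization E V → F) : Prop :=
  ∀ (n : ℕ) (v : Module.Basis (Fin n) E V), ∃ (d : ℕ) (A B : MvPolynomial (Fin n) F),
    A.IsHomogeneous d ∧ B.IsHomogeneous d ∧
    ∀ (c : Fin n → E) (hc : ∑ i, c i • v i ≠ 0),
      MvPolynomial.eval (fun i => algebraMap E F (c i)) B ≠ 0 ∧
      φ (Projectivization.mk E (∑ i, c i • v i) hc) =
        MvPolynomial.eval (fun i => algebraMap E F (c i)) A /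
          MvPolynomial.eval (fun i => algebraMap E F (c i)) B

end MahlerRiccati

end

noncomputable section

namespace MahlerRiccati

open HahnSeries Polynomial

/-! ### Coefficients of Puiseux series -/

section Coefficients

variable {E : Type*} [Field E]

/-! The Riccati equation is linearized by showing that every nonzero `u` is a quotient `M y / y`
with `y = e_λ p` (`exists_mahler_quotient`). Here `λ` is the leading coefficient of `u`, its leading
monomial `x^v` is absorbed by `x^(v/(b-1))`, and the remaining unit power series is treated by a
recursion on coefficients. The products `u (M u) ⋯ (M^{k-1} u)` telescope to `M^k y / y`, so `u`
solves (R) iff `L y = 0` (`mem_riccatiSolutions_iff`). As `λ` is read off from `u`, the classes are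
disjoint.

The structure of each class rests on `mahler_eigenvector`: an eigenvector of `M` in the Puiseux
field is a constant, with eigenvalue 1. Hence `M y / y` determines `y` up to a constant, which gives
the bijection with a projective space, and a Casorati-type argument (`card_le_of_independent`)
allows at most `r` independent solutions over all `λ` together. This yields finiteness and the
dimension bound.

For the ramification, the lowest exponent of a solution is minus the slope of a `λ`-admissible edge
(`exists_admissible_edge`). Exponents have denominators coprime with `b`, so the maps `c ↦ b^k c +
j` preserve denominators. The part of a solution with a given denominator is therefore again a
solution, and its lowest exponent exhibits that denominator as one of those entering `q_λ`. -/

theorem puiseux_ext {p q : Puiseux E}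
    (h : ∀ a, (p : HahnSeries ℚ E).coeff a = (q : HahnSeries ℚ E).coeff a) : p = q :=
  Subtype.ext (HahnSeries.ext (funext h))

theorem puiseux_exists_coeff_ne_zero {p : Puiseux E} (hp : p ≠ 0) :
    ∃ v : ℚ, (p : HahnSeries ℚ E).coeff v ≠ 0 ∧
      (p : HahnSeries ℚ E).leadingCoeff = (p : HahnSeries ℚ E).coeff v ∧
      ∀ a, (p : HahnSeries ℚ E).coeff a ≠ 0 → v ≤ a := by
  have hp' : (p : HahnSeries ℚ E) ≠ 0 := fun h => hp (Subtype.ext h)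
  refine ⟨(p : HahnSeries ℚ E).order, coeff_order_eq_zero.not.2 hp', leadingCoeff_eq, ?_⟩
  intro a ha
  by_contra hlt
  exact ha (coeff_eq_zero_of_lt_order (not_le.1 hlt))

theorem leadingCoeff_eq_coeff {p : Puiseux E} {v : ℚ} (hv : (p : HahnSeries ℚ E).coeff v ≠ 0)
    (hmin : ∀ a, (p : HahnSeries ℚ E).coeff a ≠ 0 → v ≤ a) :
    (p : HahnSeries ℚ E).leadingCoeff = (p : HahnSeries ℚ E).coeff v := by
  have hp : p ≠ 0 := by
    rintro rfl
    exact hv rfl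
  obtain ⟨w, hw, hlc, hwmin⟩ := puiseux_exists_coeff_ne_zero hp
  rw [hlc, le_antisymm (hwmin v hv) (hmin w hw)]

theorem mahler_coeff (b : ℕ) [b.AtLeastTwo] (p : Puiseux E) (a : ℚ) :
    ((mahler b E p : Puiseux E) : HahnSeries ℚ E).coeff a
      = (p : HahnSeries ℚ E).coeff (a / b) := by
  have hb : (b : ℚ) ≠ 0 := by
    have := Nat.AtLeastTwo.prop (n := b)
    exact_mod_cast (by omega : b ≠ 0)
  have h : (mahlerHahn b E (p : HahnSeries ℚ E)).coeff ((b : ℚ) * (a / b))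
      = (p : HahnSeries ℚ E).coeff (a / b) := embDomain_coeff (a := a / b)
  rw [mul_div_cancel₀ _ hb] at h
  exact h

theorem mahler_iterate_coeff (b : ℕ) [b.AtLeastTwo] (k : ℕ) (p : Puiseux E) (a : ℚ) :
    (((mahler b E)^[k] p : Puiseux E) : HahnSeries ℚ E).coeff a
      = (p : HahnSeries ℚ E).coeff (a / (b : ℚ) ^ k) := by
  induction k generalizing p with
  | zero => simp
  | succ k ih => rw [Function.iterate_succ_apply, ih, mahler_coeff, div_div, pow_succ]

theorem polyToPuiseux_mul_coeff {K : Type*} [Field K] [Algebra K E] (f : K[X]) (p : Puiseux E)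
    (a : ℚ) :
    ((polyToPuiseux K E f * p : Puiseux E) : HahnSeries ℚ E).coeff a
      = ∑ j ∈ f.support, algebraMap K E (f.coeff j) * (p : HahnSeries ℚ E).coeff (a - j) := by
  have hf : ((polyToPuiseux K E f : Puiseux E) : HahnSeries ℚ E)
      = ∑ j ∈ f.support, single (j : ℚ) (algebraMap K E (f.coeff j)) := by
    change (puiseuxField E).val (eval₂ _ _ f) = _
    rw [eval₂_def, Polynomial.sum, map_sum]
    refine Finset.sum_congr rfl fun j _ => ?_
    have hX : (puiseuxField E).val (puiseuxX E) = single (1 : ℚ) (1 : E) := rfl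
    have hC : (puiseuxField E).val (algebraMap E (Puiseux E) (algebraMap K E (f.coeff j)))
        = single (0 : ℚ) (algebraMap K E (f.coeff j)) := rfl
    rw [map_mul, map_pow, hX, RingHom.comp_apply, hC, single_pow, single_mul_single]
    simp
  rw [MulMemClass.coe_mul, hf, Finset.sum_mul, HahnSeries.coeff_sum]
  refine Finset.sum_congr rfl fun j _ => ?_
  rw [coeff_single_mul]

theorem smul_puiseux_coeff (c : E) (p : Puiseux E) (a : ℚ) :
    ((c • p : Puiseux E) : HahnSeries ℚ E).coeff a = c * (p : HahnSeries ℚ E).coeff a :=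
  rfl

/-- A coefficient function supported in the support of a Puiseux series defines a Puiseux
series. -/
def puiseuxOfSupport {E' : Type*} [Field E'] (p : Puiseux E') (c : ℚ → E)
    (hc : ∀ a, c a ≠ 0 → (p : HahnSeries ℚ E').coeff a ≠ 0) : Puiseux E :=
  ⟨⟨c, (p : HahnSeries ℚ E').isPWO_support.mono fun a ha => hc a ha⟩, by
    obtain ⟨q, hq, hp⟩ := p.2
    refine ⟨q, hq, ?_⟩
    rw [mem_ramifiedLaurent_iff] at hp ⊢
    exact fun a ha => hp a (hc a ha)⟩

@[simp]
theorem puiseuxOfSupport_coeff {E' : Type*} [Field E'] (p : Puiseux E') (c : ℚ → E)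
    (hc : ∀ a, c a ≠ 0 → (p : HahnSeries ℚ E').coeff a ≠ 0) (a : ℚ) :
    ((puiseuxOfSupport p c hc : Puiseux E) : HahnSeries ℚ E).coeff a = c a :=
  rfl

/-- The part of a Puiseux series with exponents in a given set. -/
def puiseuxRestrict (S : Set ℚ) (p : Puiseux E) : Puiseux E :=
  open Classical in
  puiseuxOfSupport p (fun a => if a ∈ S then (p : HahnSeries ℚ E).coeff a else 0)
    fun a ha h => ha (by simp [h])

open Classical in
theorem puiseuxRestrict_coeff (S : Set ℚ) (p : Puiseux E) (a : ℚ) :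
    ((puiseuxRestrict S p : Puiseux E) : HahnSeries ℚ E).coeff a
      = if a ∈ S then (p : HahnSeries ℚ E).coeff a else 0 :=
  rfl

end Coefficients

/-! ### The operator conjugated by `e_λ` -/

section TwistedOperator

variable (b : ℕ) [b.AtLeastTwo] {K : Type*} [Field K] {r : ℕ} (l : Fin (r + 1) → K[X])
  {E : Type*} [Field E] [Algebra K E]

/-- The operator `∑ λ^k ℓ_k M^k` on Puiseux series, that is `e_λ⁻¹ L e_λ`. -/
def twistedOp (lam : E) (p : Puiseux E) : Puiseux E :=
  ∑ k : Fin (r + 1), polyToPuiseux K E (l k) * (lam ^ (k : ℕ) • (mahler b E)^[k] p)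

theorem mahlerD_iterate_expTimes (lam : Eˣ) (p : Puiseux E) (k : ℕ) :
    (mahlerD b E)^[k] (expTimes lam p)
      = expTimes lam ((lam : E) ^ k • (mahler b E)^[k] p) := by
  induction k with
  | zero => simp
  | succ k ih =>
    rw [Function.iterate_succ_apply', ih, mahlerD_expTimes, map_smul,
      Function.iterate_succ_apply', smul_smul, pow_succ']

theorem linOp_expTimes (lam : Eˣ) (p : Puiseux E) :
    linOp b l (expTimes lam p) = expTimes lam (twistedOp b l (lam : E) p) := by
  simp only [linOp, mahlerD_iterate_expTimes, MonoidAlgebra.smul_single, smul_eq_mul, twistedOp,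
    expTimes]
  exact (map_sum (MonoidAlgebra.singleAddHom lam) _ _).symm

theorem expTimes_eq_zero {lam : Eˣ} {p : Puiseux E} : expTimes lam p = 0 ↔ p = 0 :=
  MonoidAlgebra.single_eq_zero

theorem linOp_expTimes_eq_zero {lam : Eˣ} {p : Puiseux E} :
    linOp b l (expTimes lam p) = 0 ↔ twistedOp b l (lam : E) p = 0 := by
  rw [linOp_expTimes, expTimes_eq_zero]

/-- The point `(b^k, j)` moves the exponent `c` to `b^k c + j`, so it contributes to `x^a` through
`c = (a - j) / b^k`. All arguments on exponents and on scalars use this formula. -/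
theorem twistedOp_coeff (lam : E) (p : Puiseux E) (a : ℚ) :
    ((twistedOp b l lam p : Puiseux E) : HahnSeries ℚ E).coeff a
      = ∑ T ∈ newtonPoints l, lam ^ (T.1 : ℕ) * algebraMap K E ((l T.1).coeff T.2) *
          (p : HahnSeries ℚ E).coeff ((a - T.2) / (b : ℚ) ^ (T.1 : ℕ)) := by
  have hs : ((twistedOp b l lam p : Puiseux E) : HahnSeries ℚ E)
      = ∑ k : Fin (r + 1), ((polyToPuiseux K E (l k) * (lam ^ (k : ℕ) • (mahler b E)^[k] p) :
        Puiseux E) : HahnSeries ℚ E) :=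
    map_sum (puiseuxField E).val _ _
  rw [hs, HahnSeries.coeff_sum, newtonPoints, Finset.sum_sigma]
  refine Finset.sum_congr rfl fun k _ => ?_
  rw [polyToPuiseux_mul_coeff]
  refine Finset.sum_congr rfl fun j _ => ?_
  rw [smul_puiseux_coeff, mahler_iterate_coeff]
  ring

end TwistedOperator

/-! ### Lowest exponents and the Newton polygon -/

section NewtonPolygon

variable (b : ℕ) [b.AtLeastTwo] {K : Type*} [Field K] {r : ℕ} {l : Fin (r + 1) → K[X]}
  {E : Type*} [Field E] [Algebra K E]

theorem mem_newtonPoints {T : Σ _ : Fin (r + 1), ℕ} :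
    T ∈ newtonPoints l ↔ (l T.1).coeff T.2 ≠ 0 := by
  simp [newtonPoints]

/-- The lowest terms produced by `x^v` come from the points on the supporting line of slope `-v`.
Their coefficients must cancel, which requires at least two points, hence an edge; the cancellation
is the equation `χ(λ) = 0`. -/
theorem exists_admissible_edge (h0 : l 0 ≠ 0) {lam : E} (hlam : lam ≠ 0) {p : Puiseux E}
    (hp : twistedOp b l lam p = 0) {v : ℚ} (hv : (p : HahnSeries ℚ E).coeff v ≠ 0)
    (hmin : ∀ a, (p : HahnSeries ℚ E).coeff a ≠ 0 → v ≤ a) :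
    ∃ e ∈ lowerEdges b l, IsAdmissible b l lam e ∧ edgeSlope b e.1 e.2 = -v := by
  classical
  have hb1 : (1 : ℚ) < b := by
    have := Nat.AtLeastTwo.prop (n := b)
    exact_mod_cast (by omega : 1 < b)
  have hbpos : ∀ k : ℕ, (0 : ℚ) < (b : ℚ) ^ k := fun k => pow_pos (by linarith) k
  -- The exponent to which the point `T` moves the lowest term `x^v`.
  let f : (Σ _ : Fin (r + 1), ℕ) → ℚ := fun T => T.2 + v * (b : ℚ) ^ (T.1 : ℕ)
  have hne : (newtonPoints l).Nonempty := by
    obtain ⟨j, hj⟩ := (Polynomial.support_nonempty).2 h0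
    exact ⟨⟨0, j⟩, mem_newtonPoints.2 (Polynomial.mem_support_iff.1 hj)⟩
  obtain ⟨T₀, hT₀, hT₀min⟩ := Finset.exists_min_image (newtonPoints l) f hne
  let N := (newtonPoints l).filter fun T => f T = f T₀
  have hmemN : ∀ T, T ∈ N ↔ T ∈ newtonPoints l ∧ f T = f T₀ := fun T => by simp [N]
  -- In the coefficient of `x^(f T₀)`, points outside `N` read `p` strictly below `v`, where it
  -- vanishes; points of `N` read it exactly at `v`.
  have hsum : ∑ T ∈ N, lam ^ (T.1 : ℕ) * algebraMap K E ((l T.1).coeff T.2) = 0 := by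
    have h := twistedOp_coeff b l lam p (f T₀)
    rw [hp] at h
    rw [← Finset.sum_filter_add_sum_filter_not _ (fun T => f T = f T₀)] at h
    rw [Finset.sum_eq_zero (s := (newtonPoints l).filter fun T => ¬ f T = f T₀), add_zero,
      Finset.sum_congr rfl (g := fun T => lam ^ (T.1 : ℕ) *
        algebraMap K E ((l T.1).coeff T.2) * (p : HahnSeries ℚ E).coeff v),
      ← Finset.sum_mul] at h
    · exact (mul_eq_zero.1 h.symm).resolve_right hv
    · intro T hT
      have hT' : f T = f T₀ := (Finset.mem_filter.1 hT).2
      have : (f T₀ - T.2) / (b : ℚ) ^ (T.1 : ℕ) = v := by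
        rw [← hT', div_eq_iff (hbpos _).ne']
        simp [f]
      rw [this]
    · intro T hT
      obtain ⟨hT1, hT2⟩ := Finset.mem_filter.1 hT
      have hlt : f T₀ < f T := lt_of_le_of_ne (hT₀min T hT1) (Ne.symm hT2)
      have hz : (p : HahnSeries ℚ E).coeff ((f T₀ - T.2) / (b : ℚ) ^ (T.1 : ℕ)) = 0 := by
        by_contra hcon
        have h1 := hmin _ hcon
        rw [le_div_iff₀ (hbpos _)] at h1
        have h2 : f T = T.2 + v * (b : ℚ) ^ (T.1 : ℕ) := rfl
        linarith
      rw [hz, mul_zero]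
  have hNne : N.Nonempty := ⟨T₀, (hmemN _).2 ⟨hT₀, rfl⟩⟩
  obtain ⟨P, hP, hPmin⟩ := Finset.exists_min_image N (fun T => T.1) hNne
  obtain ⟨Q, hQ, hQmax⟩ := Finset.exists_max_image N (fun T => T.1) hNne
  have hPf := ((hmemN P).1 hP).2
  have hQf := ((hmemN Q).1 hQ).2
  have huniq : ∀ T ∈ N, T.1 = P.1 → T = P := by
    rintro ⟨k, j⟩ hT hk
    obtain ⟨k', j'⟩ := P
    dsimp only at hk
    subst hk
    have h1 := ((hmemN _).1 hT).2.trans hPf.symm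
    have : (j : ℚ) = j' := by simpa [f] using h1
    rw [Nat.cast_injective this]
  have hPQ : P.1 < Q.1 := by
    -- With equal extreme abscissae, `N` would be a single point and `hsum` a single nonzero term.
    refine lt_of_le_of_ne (hPmin Q hQ) fun heq => ?_
    have hN : N = {P} := by
      refine Finset.eq_singleton_iff_unique_mem.2 ⟨hP, fun T hT => huniq T hT ?_⟩
      exact le_antisymm ((hQmax T hT).trans heq.ge) (hPmin T hT)
    rw [hN, Finset.sum_singleton] at hsum
    rcases mul_eq_zero.1 hsum with h | h
    · exact pow_ne_zero _ hlam h
    · exact mem_newtonPoints.1 ((hmemN P).1 hP).1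
        ((map_eq_zero_iff _ (algebraMap K E).injective).1 h)
  have hslope : edgeSlope b P Q = -v := by
    have hlt : (b : ℚ) ^ (P.1 : ℕ) < (b : ℚ) ^ (Q.1 : ℕ) := pow_lt_pow_right₀ hb1 hPQ
    rw [edgeSlope, div_eq_iff (by linarith)]
    have h := hPf.trans hQf.symm
    simp only [f] at h
    linarith
  have hline : ∀ k : Fin (r + 1), lineAt b P Q k = f T₀ - v * (b : ℚ) ^ (k : ℕ) := by
    intro k
    rw [lineAt, hslope, ← hPf]
    simp only [f]
    ring
  have hline_iff : ∀ T ∈ newtonPoints l, (lineAt b P Q T.1 = T.2 ↔ T ∈ N) := by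
    intro T hT
    rw [hline, hmemN, sub_eq_iff_eq_add]
    simp only [hT, true_and]
    exact eq_comm
  refine ⟨(P, Q), ?_, ?_, hslope⟩
  · refine Finset.mem_filter.2 ⟨Finset.mem_product.2 ⟨((hmemN P).1 hP).1, ((hmemN Q).1 hQ).1⟩,
      hPQ, fun T hT => ⟨?_, fun h => ?_⟩⟩
    · have h := hT₀min T hT
      rw [hline]
      have h2 : f T = T.2 + v * (b : ℚ) ^ (T.1 : ℕ) := rfl
      linarith
    · have hTN := (hline_iff T hT).1 h
      exact ⟨hPmin T hTN, hQmax T hTN⟩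
  · have hfilter : (newtonPoints l).filter (fun T => P.1 ≤ T.1 ∧ T.1 ≤ Q.1 ∧
        lineAt b P Q T.1 = T.2) = N := by
      ext T
      rw [Finset.mem_filter]
      constructor
      · rintro ⟨hT, -, -, h⟩
        exact (hline_iff T hT).1 h
      · intro hT
        have hT' := ((hmemN T).1 hT).1
        exact ⟨hT', hPmin T hT, hQmax T hT, (hline_iff T hT').2 hT⟩
    have hchar : charPoly b l (P, Q) =
        ∑ T ∈ N, Polynomial.C ((l T.1).coeff T.2) * X ^ ((T.1 : ℕ) - (P.1 : ℕ)) := by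
      rw [← hfilter, charPoly]
    rw [IsAdmissible, hchar, map_sum]
    -- The factor `λ^{k₁}` undoes the shift of exponents in the characteristic polynomial.
    refine (mul_eq_zero.1 ?_).resolve_left (pow_ne_zero (P.1 : ℕ) hlam)
    rw [Finset.mul_sum, ← hsum]
    refine Finset.sum_congr rfl fun T hT => ?_
    have hle : (P.1 : ℕ) ≤ T.1 := hPmin T hT
    rw [map_mul, aeval_C, map_pow, aeval_X, mul_left_comm, ← _root_.pow_add, Nat.add_sub_cancel' hle,
      mul_comm]

end NewtonPolygon

/-! ### Denominators of exponents and the ramification bound -/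

section Exponents

variable (b : ℕ) [b.AtLeastTwo] {K : Type*} [Field K] {r : ℕ} {l : Fin (r + 1) → K[X]}
  {E : Type*} [Field E] [Algebra K E]

/-- Under `hS`, all exponents of `p` contributing to `x^a` lie in `S` or none does, according to
whether `a ∈ S`. Each coefficient of the restricted equation is thus the original one or zero. -/
theorem twistedOp_restrict_eq_zero {lam : E} {p : Puiseux E} (hp : twistedOp b l lam p = 0)
    (S : Set ℚ)
    (hS : ∀ c, (p : HahnSeries ℚ E).coeff c ≠ 0 → ∀ k j : ℕ, (c ∈ S ↔ (b : ℚ) ^ k * c + j ∈ S)) :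
    twistedOp b l lam (puiseuxRestrict S p) = 0 := by
  classical
  have hb : (b : ℚ) ≠ 0 := by
    have := Nat.AtLeastTwo.prop (n := b)
    exact_mod_cast (by omega : b ≠ 0)
  refine puiseux_ext fun a => ?_
  have h := twistedOp_coeff b l lam p a
  rw [hp] at h
  rw [twistedOp_coeff]
  have key : ∀ T : Σ _ : Fin (r + 1), ℕ,
      ((puiseuxRestrict S p : Puiseux E) : HahnSeries ℚ E).coeff
        ((a - T.2) / (b : ℚ) ^ (T.1 : ℕ))
      = if a ∈ S then (p : HahnSeries ℚ E).coeff ((a - T.2) / (b : ℚ) ^ (T.1 : ℕ)) else 0 := by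
    intro T
    rw [puiseuxRestrict_coeff]
    by_cases hc : (p : HahnSeries ℚ E).coeff ((a - T.2) / (b : ℚ) ^ (T.1 : ℕ)) = 0
    · simp [hc]
    · have := hS _ hc T.1 T.2
      rw [mul_div_cancel₀ _ (pow_ne_zero _ hb), sub_add_cancel] at this
      simp only [this]
  simp only [key]
  split_ifs
  · exact h.symm
  · simp

/-- Terms with `k ≥ 1` multiply exponents by `b`, which clears the factor `gcd(b, q)` from the
denominator. A lowest exponent `v` violating the conclusion could then only be cancelled by terms of
`ℓ_0`, and the lowest term of `ℓ_0` leaves `x^(v + j₀)` uncancelled. -/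
theorem exponents_div_gcd (h0 : l 0 ≠ 0) {lam : E} {p : Puiseux E}
    (hp : twistedOp b l lam p = 0) {q : ℕ} (hq : 0 < q)
    (hpq : ∀ a, (p : HahnSeries ℚ E).coeff a ≠ 0 → ∃ n : ℤ, a = (n : ℚ) / q) :
    ∀ a, (p : HahnSeries ℚ E).coeff a ≠ 0 → ∃ n : ℤ, a = (n : ℚ) / (q / b.gcd q : ℕ) := by
  classical
  have hb : (b : ℚ) ≠ 0 := by
    have := Nat.AtLeastTwo.prop (n := b)
    exact_mod_cast (by omega : b ≠ 0)
  obtain ⟨q', hq'⟩ := Nat.gcd_dvd_right b q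
  obtain ⟨b', hb'⟩ := Nat.gcd_dvd_left b q
  have hg : 0 < b.gcd q := Nat.gcd_pos_of_pos_right _ hq
  set g := b.gcd q
  have hqg : q / g = q' := by rw [hq', Nat.mul_div_cancel_left _ hg]
  have hq'0 : (q' : ℚ) ≠ 0 := by
    rintro h
    rw [Nat.cast_eq_zero.1 h, mul_zero] at hq'
    omega
  have hg0 : (g : ℚ) ≠ 0 := by positivity
  rw [hqg]
  by_contra! hcon
  obtain ⟨a₀, ha₀, ha₀'⟩ := hcon
  let S : Set ℚ := {a | ∀ n : ℤ, a ≠ (n : ℚ) / q'}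
  have hSadd : ∀ a ∈ S, ∀ m : ℤ, a + m ∈ S := by
    intro a ha m n hn
    refine ha (n - m * q') ?_
    push_cast
    rw [sub_div, mul_div_cancel_right₀ _ hq'0, ← hn, add_sub_cancel_right]
  have hne : puiseuxRestrict S p ≠ 0 := by
    intro h
    have h1 : ((puiseuxRestrict S p : Puiseux E) : HahnSeries ℚ E).coeff a₀ = 0 := by rw [h]; rfl
    rw [puiseuxRestrict_coeff, if_pos (show a₀ ∈ S from ha₀')] at h1
    exact ha₀ h1
  obtain ⟨v, hv, -, hvmin⟩ := puiseux_exists_coeff_ne_zero hne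
  have hvS : v ∈ S := by
    by_contra h
    exact hv (by rw [puiseuxRestrict_coeff, if_neg (show v ∉ S from h)])
  rw [puiseuxRestrict_coeff, if_pos hvS] at hv
  have hvmin' : ∀ a ∈ S, (p : HahnSeries ℚ E).coeff a ≠ 0 → v ≤ a := by
    intro a ha hpa
    refine hvmin a ?_
    rwa [puiseuxRestrict_coeff, if_pos ha]
  set j₀ := (l 0).natTrailingDegree
  have hj₀ : (l 0).coeff j₀ ≠ 0 := Polynomial.trailingCoeff_nonzero_iff_nonzero.2 h0
  have h := twistedOp_coeff b l lam p (v + j₀)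
  rw [hp, Finset.sum_eq_single ⟨0, j₀⟩] at h
  · simp only [Fin.val_zero, pow_zero, one_mul, div_one, add_sub_cancel_right] at h
    rcases mul_eq_zero.1 h.symm with h | h
    · exact hj₀ ((map_eq_zero_iff _ (algebraMap K E).injective).1 h)
    · exact hv h
  · rintro ⟨k, j⟩ hT hTne
    refine mul_eq_zero_of_right _ ?_
    by_contra hc
    -- For `k = 0` and `j > j₀`, the exponent `v + j₀ - j` would be a smaller element of `S`; for `k
    -- ≥ 1`, `v + j₀ - j` would lie in `(1/q')ℤ`, hence so would `v`.
    by_cases hk : k = 0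
    · subst hk
      simp only [Fin.val_zero, pow_zero, div_one] at hc
      have hjle : j₀ ≤ j := Polynomial.natTrailingDegree_le_of_ne_zero (mem_newtonPoints.1 hT)
      have hjne : j ≠ j₀ := fun h => hTne (by rw [h])
      have hjlt : (j₀ : ℚ) < j := by exact_mod_cast lt_of_le_of_ne hjle hjne.symm
      have hmem : v + j₀ - j ∈ S := by
        have := hSadd v hvS (j₀ - j)
        push_cast at this
        rwa [← add_sub_assoc] at this
      have := hvmin' _ hmem hc
      linarith
    · obtain ⟨n, hn⟩ := hpq _ hc
      obtain ⟨k', hk'⟩ : ∃ k', (k : ℕ) = k' + 1 :=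
        Nat.exists_eq_succ_of_ne_zero fun h => hk (Fin.ext h)
      rw [div_eq_iff (pow_ne_zero _ hb), hk'] at hn
      have hmem : v + j₀ + ((-j : ℤ) : ℚ) ∈ S := by
        have := hSadd _ (hSadd v hvS j₀) (-j)
        simpa using this
      refine hmem (n * b' * b ^ k') ?_
      have hbq : (b : ℚ) = g * b' := by exact_mod_cast hb'
      have hqq : (q : ℚ) = g * q' := by exact_mod_cast hq'
      push_cast
      rw [← sub_eq_add_neg, hn, pow_succ]
      rw [hqq]
      nth_rewrite 2 [hbq]
      field_simp
  · intro hT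
    exact absurd (mem_newtonPoints.2 hj₀) hT

/-- The least common denominator works: a common factor with `b` could be divided out by
`exponents_div_gcd`. -/
theorem exists_coprime_exponents (h0 : l 0 ≠ 0) {lam : E} {p : Puiseux E}
    (hp : twistedOp b l lam p = 0) :
    ∃ q : ℕ, 0 < q ∧ Nat.Coprime b q ∧
      ∀ a, (p : HahnSeries ℚ E).coeff a ≠ 0 → ∃ n : ℤ, a = (n : ℚ) / q := by
  classical
  have hex : ∃ q : ℕ, 0 < q ∧
      ∀ a, (p : HahnSeries ℚ E).coeff a ≠ 0 → ∃ n : ℤ, a = (n : ℚ) / q := by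
    obtain ⟨q, hq, h⟩ := p.2
    exact ⟨q, hq, (mem_ramifiedLaurent_iff hq _).1 h⟩
  obtain ⟨hq, hpq⟩ := Nat.find_spec hex
  refine ⟨Nat.find hex, hq, ?_, hpq⟩
  by_contra hg
  have hgpos : 0 < b.gcd (Nat.find hex) := Nat.gcd_pos_of_pos_right _ hq
  have hlt : Nat.find hex / b.gcd (Nat.find hex) < Nat.find hex :=
    Nat.div_lt_self hq (by have : b.gcd (Nat.find hex) ≠ 1 := hg; omega)
  exact Nat.find_min hex hlt ⟨Nat.div_pos (Nat.le_of_dvd hq (Nat.gcd_dvd_right _ _)) hgpos,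
    exponents_div_gcd b h0 hp hq hpq⟩

/-- This makes the sets of exponents of fixed denominator admissible in
`twistedOp_restrict_eq_zero`. -/
theorem den_pow_mul_add (b : ℕ) {c : ℚ} (hc : Nat.Coprime b c.den) (k j : ℕ) :
    ((b : ℚ) ^ k * c + j).den = c.den := by
  have h1 : ((b : ℚ) ^ k * c).den = c.den := by
    have h2 : (b : ℚ) ^ k = ((b ^ k : ℕ) : ℚ) := by push_cast; rfl
    rw [h2, Rat.mul_den]
    simp only [Rat.den_natCast, Rat.num_natCast, one_mul]
    have : Nat.Coprime (((b ^ k : ℕ) : ℤ) * c.num).natAbs c.den := by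
      rw [Int.natAbs_mul, Int.natAbs_natCast]
      exact Nat.Coprime.mul_left (hc.pow_left k) c.reduced
    rw [this.gcd_eq_one, Nat.div_one]
  rw [Rat.add_natCast_den, h1]

/-- The part of `p` whose exponents have denominator `a.den` is a nonzero solution. Its lowest
exponent is minus the slope of an admissible edge, so `a.den` is one of the denominators in the lcm.
-/
theorem den_dvd_ramBound (h0 : l 0 ≠ 0) {lam : E} (hlam : lam ≠ 0) {p : Puiseux E}
    (hp : twistedOp b l lam p = 0) {a : ℚ} (ha : (p : HahnSeries ℚ E).coeff a ≠ 0) :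
    a.den ∣ ramBound b l lam := by
  classical
  obtain ⟨q, hq, hqb, hpq⟩ := exists_coprime_exponents b h0 hp
  have hcop : ∀ c, (p : HahnSeries ℚ E).coeff c ≠ 0 → Nat.Coprime b c.den := by
    intro c hc
    obtain ⟨n, rfl⟩ := hpq c hc
    refine hqb.coprime_dvd_right ?_
    have := Rat.den_dvd n q
    rw [Rat.divInt_eq_div] at this
    exact_mod_cast this
  let S : Set ℚ := {c | c.den = a.den}
  have hsol : twistedOp b l lam (puiseuxRestrict S p) = 0 := by
    refine twistedOp_restrict_eq_zero b hp S fun c hc k j => ?_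
    simp only [S, Set.mem_ofPred_eq]
    rw [den_pow_mul_add b (hcop c hc)]
  have hne : puiseuxRestrict S p ≠ 0 := by
    intro h
    have h1 : ((puiseuxRestrict S p : Puiseux E) : HahnSeries ℚ E).coeff a = 0 := by rw [h]; rfl
    rw [puiseuxRestrict_coeff, if_pos (show a ∈ S from rfl)] at h1
    exact ha h1
  obtain ⟨v, hv, -, hvmin⟩ := puiseux_exists_coeff_ne_zero hne
  obtain ⟨e, he, hadm, hslope⟩ := exists_admissible_edge b h0 hlam hsol hv hvmin
  have hvS : v.den = a.den := by
    by_contra h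
    exact hv (by rw [puiseuxRestrict_coeff, if_neg (show v ∉ S from h)])
  have hden : (edgeSlope b e.1 e.2).den = a.den := by rw [hslope, Rat.neg_den, hvS]
  have hmem : e ∈ (lowerEdges b l).filter fun e =>
      IsAdmissible b l lam e ∧ Nat.Coprime b (edgeSlope b e.1 e.2).den :=
    Finset.mem_filter.2 ⟨he, hadm, hden ▸ hcop a ha⟩
  have hdvd := Finset.dvd_lcm (f := fun e => (edgeSlope b e.1 e.2).den) hmem
  rw [← hden, ramBound]
  convert hdvd

theorem mem_ramifiedLaurent_of_twistedOp_eq_zero (h0 : l 0 ≠ 0) {lam : E} (hlam : lam ≠ 0)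
    {p : Puiseux E} (hp : twistedOp b l lam p = 0) :
    (p : HahnSeries ℚ E) ∈ ramifiedLaurent E (ramBound b l lam) (ramBound_pos b l lam) := by
  rw [mem_ramifiedLaurent_iff]
  intro a ha
  obtain ⟨m, hm⟩ := den_dvd_ramBound b h0 hlam hp ha
  have hpos := ramBound_pos b l lam
  have hm0 : (m : ℚ) ≠ 0 := by
    intro h
    rw [Nat.cast_eq_zero.1 h, mul_zero] at hm
    omega
  refine ⟨a.num * m, ?_⟩
  rw [hm]
  push_cast
  rw [mul_div_mul_right _ _ hm0, Rat.num_div_den]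

end Exponents

/-! ### Change of the coefficient field -/

section Scalars

variable (b : ℕ) [b.AtLeastTwo] {K : Type*} [Field K] {r : ℕ} {l : Fin (r + 1) → K[X]}
  {E E' : Type*} [Field E] [Algebra K E] [Field E'] [Algebra K E'] [Algebra E E']
  [IsScalarTower K E E']

theorem exists_solution_extend {lam : E} {p : Puiseux E} (hp0 : p ≠ 0)
    (hp : twistedOp b l lam p = 0) :
    ∃ p' : Puiseux E', p' ≠ 0 ∧ twistedOp b l (algebraMap E E' lam) p' = 0 := by
  let p' : Puiseux E' := puiseuxOfSupport p
    (fun a => algebraMap E E' ((p : HahnSeries ℚ E).coeff a)) fun a ha h => ha (by rw [h, map_zero])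
  refine ⟨p', ?_, puiseux_ext fun a => ?_⟩
  · obtain ⟨v, hv, -⟩ := puiseux_exists_coeff_ne_zero hp0
    intro h
    have h1 : (p' : HahnSeries ℚ E').coeff v = 0 := by rw [h]; rfl
    exact hv ((map_eq_zero_iff _ (algebraMap E E').injective).1 h1)
  · have h := twistedOp_coeff b l lam p a
    rw [hp] at h
    have h' := congrArg (algebraMap E E') h
    rw [map_sum] at h'
    rw [twistedOp_coeff]
    refine Eq.trans (Finset.sum_congr rfl fun T _ => ?_) (h'.symm.trans (map_zero _))
    rw [map_mul, map_mul, map_pow, ← IsScalarTower.algebraMap_apply, puiseuxOfSupport_coeff]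

/-- The equations on coefficients are linear over `E`, so an `E`-linear form applied to every
coefficient preserves them. It is chosen nonzero on one coefficient of `p'`. -/
theorem exists_solution_descend {lam : E} {p' : Puiseux E'} (hp0 : p' ≠ 0)
    (hp : twistedOp b l (algebraMap E E' lam) p' = 0) :
    ∃ p : Puiseux E, p ≠ 0 ∧ twistedOp b l lam p = 0 := by
  obtain ⟨v, hv, -⟩ := puiseux_exists_coeff_ne_zero hp0
  obtain ⟨π, hπ⟩ : ∃ π : Module.Dual E E', π ((p' : HahnSeries ℚ E').coeff v) ≠ 0 := by
    by_contra! h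
    exact hv ((Module.forall_dual_apply_eq_zero_iff E _).1 h)
  let p : Puiseux E := puiseuxOfSupport p'
    (fun a => π ((p' : HahnSeries ℚ E').coeff a)) fun a ha h => ha (by rw [h, map_zero])
  refine ⟨p, ?_, puiseux_ext fun a => ?_⟩
  · intro h
    have h1 : (p : HahnSeries ℚ E).coeff v = 0 := by rw [h]; rfl
    exact hπ h1
  · have h := twistedOp_coeff b l (algebraMap E E' lam) p' a
    rw [hp] at h
    have h' := congrArg π h
    rw [map_sum] at h'
    rw [twistedOp_coeff]
    refine Eq.trans (Finset.sum_congr rfl fun T _ => ?_) (h'.symm.trans (map_zero _))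
    rw [puiseuxOfSupport_coeff, IsScalarTower.algebraMap_apply K E E', ← map_pow, ← map_mul,
      ← Algebra.smul_def, map_smul, smul_eq_mul]

end Scalars

/-! ### Constants of `M` and independence of solutions -/

section Independence

variable (b : ℕ) [b.AtLeastTwo] {E : Type*} [Field E]

/-- The support is stable under multiplication and division by `b`, so its least element `v`
satisfies `v ≤ v / b` and `v ≤ b v`, that is, `v = 0`. Comparing constant terms gives `mu = 1`;
subtracting the constant term leaves a fixed series without constant term, which is zero. -/
theorem mahler_eigenvector {mu : E} (hmu : mu ≠ 0) {c : Puiseux E} (hc : c ≠ 0)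
    (h : mahler b E c = mu • c) : mu = 1 ∧ ∃ e : E, c = algebraMap E (Puiseux E) e := by
  have hb1 : (1 : ℚ) < b := by
    have := Nat.AtLeastTwo.prop (n := b)
    exact_mod_cast (by omega : 1 < b)
  have hcoeff : ∀ (ν : E) (d : Puiseux E), mahler b E d = ν • d → ∀ a,
      (d : HahnSeries ℚ E).coeff (a / b) = ν * (d : HahnSeries ℚ E).coeff a := by
    intro ν d hd a
    rw [← mahler_coeff, hd, smul_puiseux_coeff]
  have hzero : ∀ (ν : E) (d : Puiseux E), ν ≠ 0 → d ≠ 0 → mahler b E d = ν • d →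
      (d : HahnSeries ℚ E).coeff 0 ≠ 0 := by
    intro ν d hν hd h
    obtain ⟨v, hv, -, hmin⟩ := puiseux_exists_coeff_ne_zero hd
    have h1 : v ≤ v / b := hmin _ (by rw [hcoeff ν d h]; exact mul_ne_zero hν hv)
    have h2 : v ≤ b * v := by
      refine hmin _ fun h0 => hv ?_
      have := hcoeff ν d h (b * v)
      rwa [mul_div_cancel_left₀ _ (by linarith : (b : ℚ) ≠ 0), h0, mul_zero] at this
    rw [le_div_iff₀ (by linarith)] at h1
    have : v = 0 := by nlinarith
    rwa [this] at hv
  have hc0 := hzero mu c hmu hc h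
  have hmu1 : mu = 1 := by
    have := hcoeff mu c h 0
    rw [zero_div] at this
    exact mul_right_cancel₀ hc0 (by rw [one_mul]; exact this.symm)
  refine ⟨hmu1, (c : HahnSeries ℚ E).coeff 0, ?_⟩
  subst hmu1
  by_contra hne
  refine hzero 1 (c - algebraMap E (Puiseux E) ((c : HahnSeries ℚ E).coeff 0)) one_ne_zero
    (sub_ne_zero.2 hne) ?_ ?_
  · rw [map_sub, h, one_smul, one_smul, AlgHom.commutes]
  · change (c : HahnSeries ℚ E).coeff 0
      - (single (0 : ℚ) ((c : HahnSeries ℚ E).coeff 0)).coeff 0 = 0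
    rw [coeff_single_same, sub_self]

theorem polyToPuiseux_ne_zero {K : Type*} [Field K] [Algebra K E] {f : K[X]} (hf : f ≠ 0) :
    polyToPuiseux K E f ≠ 0 := by
  intro h
  have h1 := polyToPuiseux_mul_coeff (E := E) f 1 f.natDegree
  rw [h, zero_mul, Finset.sum_eq_single f.natDegree] at h1
  · have h2 : ((1 : Puiseux E) : HahnSeries ℚ E).coeff ((f.natDegree : ℚ) - f.natDegree) = 1 := by
      rw [sub_self]
      exact coeff_single_same 0 1
    rw [h2, mul_one] at h1
    exact hf (Polynomial.leadingCoeff_eq_zero.1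
      ((map_eq_zero_iff _ (algebraMap K E).injective).1 h1.symm))
  · intro j _ hj
    have h2 : ((1 : Puiseux E) : HahnSeries ℚ E).coeff ((f.natDegree : ℚ) - j) = 0 := by
      refine coeff_single_of_ne fun h => hj ?_
      exact_mod_cast (sub_eq_zero.1 h).symm
    rw [h2, mul_zero]
  · intro hj
    exact absurd (Polynomial.natDegree_mem_support_of_nonzero hf) hj

/-- Solutions of `L y = 0` in the spaces `e_λ Puiseux(E)` that are linearly independent over
the constants are at most `r` in number. -/
theorem card_le_of_independent {K : Type*} [Field K] {r : ℕ} {l : Fin (r + 1) → K[X]}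
    [Algebra K E] (h0 : l 0 ≠ 0) (hr : l (Fin.last r) ≠ 0)
    {ι : Type*} [Fintype ι] (lam : ι → Eˣ) (p : ι → Puiseux E)
    (hsol : ∀ i, twistedOp b l (lam i : E) (p i) = 0)
    (hind : ∀ (c : ι → E) (μ : Eˣ), (∀ i, c i ≠ 0 → lam i = μ) → ∑ i, c i • p i = 0 → c = 0) :
    Fintype.card ι ≤ r := by
  classical
  have hpoly : ∀ f : K[X], f ≠ 0 → polyToPuiseux K E f ≠ 0 := fun _ => polyToPuiseux_ne_zero
  -- `W i k` is the Puiseux factor of `M^k (e_{λ_i} p_i)`: an entry of the Casorati matrix.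
  let W : ι → ℕ → Puiseux E := fun i k => (lam i : E) ^ k • (mahler b E)^[k] (p i)
  let S : (ι → Puiseux E) → ℕ → Puiseux E := fun c k => ∑ i, c i * W i k
  have hS : ∀ c, ∑ k : Fin (r + 1), polyToPuiseux K E (l k) * S c k = 0 := by
    intro c
    simp only [S, Finset.mul_sum]
    rw [Finset.sum_comm]
    refine Finset.sum_eq_zero fun i _ => ?_
    have : ∑ k : Fin (r + 1), polyToPuiseux K E (l k) * W i k = 0 := hsol i
    rw [← mul_zero (c i), ← this, Finset.mul_sum]
    exact Finset.sum_congr rfl fun k _ => mul_left_comm _ _ _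
  have hone : ∀ c (k₀ : Fin (r + 1)), l k₀ ≠ 0 → (∀ k : Fin (r + 1), k ≠ k₀ → S c k = 0) →
      S c k₀ = 0 := by
    intro c k₀ hk₀ h
    have h1 := hS c
    rw [Finset.sum_eq_single k₀ (fun k _ hk => by rw [h k hk, mul_zero])
      (fun h => absurd (Finset.mem_univ _) h)] at h1
    exact (mul_eq_zero.1 h1).resolve_left (hpoly _ hk₀)
  have hext : ∀ c, (∀ k < r, S c k = 0) → ∀ k ≤ r, S c k = 0 := by
    intro c h k hk
    rcases hk.lt_or_eq with hk | rfl
    · exact h k hk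
    · exact hone c (Fin.last k) hr fun j hj => h j (Fin.val_lt_last hj)
  have hW : ∀ i k, mahler b E (W i k) = (lam i : E)⁻¹ • W i (k + 1) := by
    intro i k
    simp only [W]
    rw [map_smul, ← Function.iterate_succ_apply' (mahler b E), smul_smul, pow_succ',
      inv_mul_cancel_left₀ (Units.ne_zero _)]
  -- Induction on the number of nonzero coefficients of a relation.
  have key : ∀ (n : ℕ) (c : ι → Puiseux E), (Finset.univ.filter fun i => c i ≠ 0).card = n →
      (∀ k < r, S c k = 0) → c = 0 := by
    intro n
    induction n using Nat.strong_induction_on with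
    | _ n ih =>
      intro c₀ hn hc₀
      by_contra hne
      obtain ⟨i₀, hi₀⟩ := Function.ne_iff.1 hne
      rw [Pi.zero_apply] at hi₀
      let c : ι → Puiseux E := fun i => (c₀ i₀)⁻¹ * c₀ i
      have hci₀ : c i₀ = 1 := inv_mul_cancel₀ hi₀
      have hcS : ∀ k ≤ r, S c k = 0 := by
        intro k hk
        have : S c k = (c₀ i₀)⁻¹ * S c₀ k := by
          simp only [S, c, Finset.mul_sum, mul_assoc]
        rw [this, hext c₀ hc₀ k hk, mul_zero]
      -- Subtracting `λ_{i₀} M` of relation `k` from relation `k + 1` gives a relation with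
      -- coefficients `d`. It is shorter, since `c i₀ = 1` is fixed by `M`.
      let d : ι → Puiseux E := fun i =>
        c i - ((lam i₀ : E) * (lam i : E)⁻¹) • mahler b E (c i)
      have hdS : ∀ k < r, S d (k + 1) = 0 := by
        intro k hk
        have h1 : S d (k + 1) = S c (k + 1) - (lam i₀ : E) • mahler b E (S c k) := by
          simp only [S, d, map_sum, map_mul, hW, Finset.smul_sum, ← Finset.sum_sub_distrib]
          refine Finset.sum_congr rfl fun i _ => ?_
          generalize W i (k + 1) = w
          rw [sub_mul, mul_smul_comm, smul_smul, smul_mul_assoc]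
        rw [h1, hcS _ hk, hcS _ hk.le, map_zero, smul_zero, sub_zero]
      -- The shift only yields the indices `1, …, r`; index `0` follows from the equation because
      -- `ℓ_0 ≠ 0`.
      have hd0 : ∀ k < r, S d k = 0 := by
        have h2 : S d ((0 : Fin (r + 1)) : ℕ) = 0 := by
          refine hone d 0 h0 fun k hk => ?_
          obtain ⟨k', hk'⟩ : ∃ k', (k : ℕ) = k' + 1 :=
            Nat.exists_eq_succ_of_ne_zero fun h => hk (Fin.ext h)
          rw [hk']
          exact hdS k' (by have := k.2; omega)
        intro k hk
        cases k with
        | zero => exact h2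
        | succ k => exact hdS k (by omega)
      have hdi₀ : d i₀ = 0 := by
        simp only [d, hci₀, map_one]
        rw [mul_inv_cancel₀ (Units.ne_zero _), one_smul, sub_self]
      have hd : d = 0 := by
        refine ih _ ?_ d rfl hd0
        rw [← hn]
        refine Finset.card_lt_card (Finset.ssubset_iff_of_subset ?_ |>.2 ⟨i₀, ?_, ?_⟩)
        · intro i hi
          simp only [Finset.mem_filter, Finset.mem_univ, true_and] at hi ⊢
          intro h
          apply hi
          simp only [d, c, h, mul_zero, map_zero, smul_zero, sub_zero]
        · simpa using hi₀
        · simp [hdi₀]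
      -- `d = 0` makes each nonzero `c i` an eigenvector of `M` with eigenvalue `λ_i / λ_{i₀}`.
      have hconst : ∀ i, ∃ e : E, c i = algebraMap E (Puiseux E) e ∧ (e ≠ 0 → lam i = lam i₀) := by
        intro i
        by_cases hci : c i = 0
        · exact ⟨0, by rw [hci, map_zero], fun h => absurd rfl h⟩
        · have h1 : c i = ((lam i₀ : E) * (lam i : E)⁻¹) • mahler b E (c i) :=
            sub_eq_zero.1 (congrFun hd i)
          have h2 : mahler b E (c i) = ((lam i : E) * (lam i₀ : E)⁻¹) • c i := by
            conv_rhs => rw [h1]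
            rw [smul_smul, mul_assoc, inv_mul_cancel_left₀ (Units.ne_zero _),
              mul_inv_cancel₀ (Units.ne_zero _), one_smul]
          obtain ⟨h3, e, he⟩ := mahler_eigenvector b
            (mul_ne_zero (Units.ne_zero _) (inv_ne_zero (Units.ne_zero _))) hci h2
          refine ⟨e, he, fun _ => Units.ext ?_⟩
          rwa [mul_inv_eq_one₀ (Units.ne_zero _)] at h3
      choose e he helam using hconst
      have he0 : e = 0 := by
        refine hind e (lam i₀) helam ?_
        have h1 := hcS 0 (Nat.zero_le _)
        rw [← h1]
        refine Finset.sum_congr rfl fun i _ => ?_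
        simp only [W, pow_zero, one_smul, Function.iterate_zero, id]
        rw [he, Algebra.smul_def]
      have h1 : c i₀ = 0 := by rw [he, he0, Pi.zero_apply, map_zero]
      rw [hci₀] at h1
      exact one_ne_zero h1
  have hli : LinearIndependent (Puiseux E) (fun i => fun k : Fin r => W i k) := by
    rw [Fintype.linearIndependent_iff]
    intro c hc i
    refine congrFun (key _ c rfl fun k hk => ?_) i
    have := congrFun hc ⟨k, hk⟩
    simpa [S] using this
  simpa using hli.fintype_card_le_finrank

end Independence

/-! ### First-order equations `M y = u y` -/

section FirstOrder

variable (b : ℕ) [b.AtLeastTwo] {E : Type*} [Field E]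

/-- The power series in `x ^ (1 / q)` as Puiseux series. -/
def rootPowerSeries (q : ℕ) (hq : 0 < q) : PowerSeries E →+* Puiseux E :=
  ((embDomainRingHom
    ({ toFun := fun n => (n : ℚ) / q
       map_zero' := by simp
       map_add' := fun m n => by push_cast; ring } : ℕ →+ ℚ)
    (fun m n h => by
      have hq' : (q : ℚ) ≠ 0 := by positivity
      have h' : (m : ℚ) / q = (n : ℚ) / q := h
      exact_mod_cast (div_left_inj' hq').1 h')
    (fun m n => by
      have hq' : (0 : ℚ) < q := by positivity
      change (m : ℚ) / q ≤ (n : ℚ) / q ↔ m ≤ n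
      rw [div_le_div_iff_of_pos_right hq']
      exact_mod_cast Iff.rfl)).comp
    (HahnSeries.toPowerSeries (R := E)).symm.toRingHom).codRestrict (puiseuxField E) fun f => by
      refine ⟨q, hq, ?_⟩
      rw [mem_ramifiedLaurent_iff]
      intro a ha
      by_contra h
      apply ha
      apply embDomain_of_notMem_range
      rintro ⟨n, hn⟩
      exact h ⟨n, hn.symm⟩

theorem rootPowerSeries_coeff (q : ℕ) (hq : 0 < q) (f : PowerSeries E) (n : ℕ) :
    ((rootPowerSeries q hq f : Puiseux E) : HahnSeries ℚ E).coeff ((n : ℚ) / q)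
      = PowerSeries.coeff n f :=
  embDomain_coeff (x := (HahnSeries.toPowerSeries (R := E)).symm f) (a := n)

theorem rootPowerSeries_coeff_eq_zero (q : ℕ) (hq : 0 < q) (f : PowerSeries E) (a : ℚ)
    (ha : ∀ n : ℕ, a ≠ (n : ℚ) / q) :
    ((rootPowerSeries q hq f : Puiseux E) : HahnSeries ℚ E).coeff a = 0 := by
  apply embDomain_of_notMem_range
  rintro ⟨n, hn⟩
  exact ha n hn.symm

/-- The coefficients of the normalized solution `h` of `g(0) h(x^b) = g(x) h(x)`. -/
def mahlerSolutionCoeff (g : PowerSeries E) : ℕ → E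
  | 0 => 1
  | n + 1 =>
    (if b ∣ n + 1 then
      have : (n + 1) / b < n + 1 := Nat.div_lt_self n.succ_pos (Nat.AtLeastTwo.prop (n := b))
      mahlerSolutionCoeff g ((n + 1) / b) else 0)
      - (PowerSeries.constantCoeff g)⁻¹ * ∑ j : Fin (n + 1),
          mahlerSolutionCoeff g j * PowerSeries.coeff (n + 1 - j) g

/-- Here `h'` plays the role of `h(x^b)`. In degree `n + 1` the equation determines the coefficient
of `h` from earlier ones, because `(n + 1) / b < n + 1` and `g(0)` is invertible; in degree `0` it
holds automatically. -/
theorem exists_powerSeries_mahler (g : PowerSeries E) (hg : PowerSeries.constantCoeff g ≠ 0) :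
    ∃ h h' : PowerSeries E, PowerSeries.constantCoeff h = 1 ∧
      (∀ n, PowerSeries.coeff (b * n) h' = PowerSeries.coeff n h) ∧
      (∀ n, ¬ b ∣ n → PowerSeries.coeff n h' = 0) ∧
      PowerSeries.constantCoeff g • h' = g * h := by
  have hb : 0 < b := by
    have := Nat.AtLeastTwo.prop (n := b)
    omega
  refine ⟨PowerSeries.mk (mahlerSolutionCoeff b g),
    PowerSeries.mk fun n => if b ∣ n then mahlerSolutionCoeff b g (n / b) else 0, ?_, ?_, ?_, ?_⟩
  · rw [← PowerSeries.coeff_zero_eq_constantCoeff_apply, PowerSeries.coeff_mk, mahlerSolutionCoeff]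
  · intro n
    rw [PowerSeries.coeff_mk, PowerSeries.coeff_mk, if_pos (dvd_mul_right b n),
      Nat.mul_div_cancel_left _ hb]
  · intro n hn
    rw [PowerSeries.coeff_mk, if_neg hn]
  · ext n
    rw [mul_comm g, PowerSeries.coeff_smul, PowerSeries.coeff_mk, PowerSeries.coeff_mul,
      Finset.Nat.sum_antidiagonal_eq_sum_range_succ
        (fun i j => PowerSeries.coeff i (PowerSeries.mk (mahlerSolutionCoeff b g)) *
          PowerSeries.coeff j g), Finset.sum_range_succ, Nat.sub_self,
      PowerSeries.coeff_zero_eq_constantCoeff_apply]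
    simp only [PowerSeries.coeff_mk, smul_eq_mul]
    cases n with
    | zero => simp [mahlerSolutionCoeff, mul_comm]
    | succ n =>
      rw [Finset.sum_range]
      have hrec : mahlerSolutionCoeff b g (n + 1) =
          (if b ∣ n + 1 then mahlerSolutionCoeff b g ((n + 1) / b) else 0)
            - (PowerSeries.constantCoeff g)⁻¹ * ∑ j : Fin (n + 1),
              mahlerSolutionCoeff b g j * PowerSeries.coeff (n + 1 - j) g := by
        rw [mahlerSolutionCoeff]
      rw [hrec]
      field_simp
      ring

/-- The Puiseux series `x ^ v`. -/
def puiseuxMonomial (v : ℚ) : Puiseux E :=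
  ⟨single v (1 : E), v.den, v.den_pos, by
    rw [mem_ramifiedLaurent_iff]
    intro a ha
    by_cases h : a = v
    · exact ⟨v.num, by rw [h, Rat.num_div_den]⟩
    · exact absurd (coeff_single_of_ne h) ha⟩

theorem puiseuxMonomial_mul_coeff (v : ℚ) (p : Puiseux E) (a : ℚ) :
    ((puiseuxMonomial v * p : Puiseux E) : HahnSeries ℚ E).coeff a
      = (p : HahnSeries ℚ E).coeff (a - v) := by
  rw [MulMemClass.coe_mul]
  change (single v (1 : E) * (p : HahnSeries ℚ E)).coeff a = _
  rw [coeff_single_mul, one_mul]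

/-- Every nonzero Puiseux series is `M y / y` for some `y = e_λ p`. -/
theorem exists_mahler_quotient {u : Puiseux E} (hu : u ≠ 0) :
    ∃ (lam : Eˣ) (p : Puiseux E), p ≠ 0 ∧ (lam : E) • mahler b E p = u * p := by
  have hb1 : (1 : ℚ) < b := by
    have := Nat.AtLeastTwo.prop (n := b)
    exact_mod_cast (by omega : 1 < b)
  have hb0 : (b : ℚ) ≠ 0 := by linarith
  obtain ⟨v, hv, -, hmin⟩ := puiseux_exists_coeff_ne_zero hu
  obtain ⟨q, hq, huq⟩ := u.2
  rw [mem_ramifiedLaurent_iff] at huq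
  have hq0 : (0 : ℚ) < q := by exact_mod_cast hq
  obtain ⟨m, hm⟩ := huq v hv
  -- Factorization `u = x^v g(x^{1/q})` with `g(0) ≠ 0`.
  let g : PowerSeries E := PowerSeries.mk fun n => (u : HahnSeries ℚ E).coeff (v + n / q)
  have hg0 : PowerSeries.constantCoeff g = (u : HahnSeries ℚ E).coeff v := by
    rw [← PowerSeries.coeff_zero_eq_constantCoeff_apply, PowerSeries.coeff_mk]
    simp
  have hug : u = puiseuxMonomial v * rootPowerSeries q hq g := by
    refine puiseux_ext fun a => ?_
    rw [puiseuxMonomial_mul_coeff]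
    by_cases ha : ∃ n : ℕ, a - v = (n : ℚ) / q
    · obtain ⟨n, hn⟩ := ha
      rw [hn, rootPowerSeries_coeff, PowerSeries.coeff_mk, ← hn, add_sub_cancel]
    · push Not at ha
      rw [rootPowerSeries_coeff_eq_zero q hq g _ ha]
      by_contra hne
      obtain ⟨n, hn⟩ := huq a hne
      have hle := hmin a hne
      rw [hn, hm, div_le_div_iff_of_pos_right hq0] at hle
      have hle' : m ≤ n := by exact_mod_cast hle
      refine ha (n - m).toNat ?_
      have : (((n - m).toNat : ℕ) : ℚ) = ((n - m : ℤ) : ℚ) := by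
        exact_mod_cast congrArg (Int.cast (R := ℚ)) (Int.toNat_of_nonneg (sub_nonneg.2 hle'))
      rw [this, hn, hm]
      push_cast
      ring
  obtain ⟨h, h', hh, hh1, hh2, hh3⟩ := exists_powerSeries_mahler b g (by rwa [hg0])
  have hMh : mahler b E (rootPowerSeries q hq h) = rootPowerSeries q hq h' := by
    refine puiseux_ext fun a => ?_
    rw [mahler_coeff]
    by_cases ha : ∃ n : ℕ, a / b = (n : ℚ) / q
    · obtain ⟨n, hn⟩ := ha
      have : a = ((b * n : ℕ) : ℚ) / q := by
        rw [div_eq_iff hb0] at hn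
        rw [hn]
        push_cast
        ring
      rw [hn, rootPowerSeries_coeff, this, rootPowerSeries_coeff, hh1]
    · push Not at ha
      rw [rootPowerSeries_coeff_eq_zero q hq h _ ha]
      by_cases ha' : ∃ n : ℕ, a = (n : ℚ) / q
      · obtain ⟨n, rfl⟩ := ha'
        rw [rootPowerSeries_coeff, hh2]
        rintro ⟨k, rfl⟩
        refine ha k ?_
        push_cast
        field_simp
      · push Not at ha'
        rw [rootPowerSeries_coeff_eq_zero q hq h' _ ha']
  -- Chosen so that `b w = v + w`, whence `M x^w = x^v x^w`.
  set w : ℚ := v / (b - 1) with hw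
  have hbw : (b : ℚ) * w = v + w := by
    have : (b : ℚ) - 1 ≠ 0 := by linarith
    rw [hw]
    field_simp
    ring
  have hMw : mahler b E (puiseuxMonomial w) = puiseuxMonomial v * puiseuxMonomial w := by
    refine puiseux_ext fun a => ?_
    rw [mahler_coeff, puiseuxMonomial_mul_coeff]
    change (single w (1 : E)).coeff _ = (single w (1 : E)).coeff _
    have : a / b = w ↔ a - v = w := by
      rw [div_eq_iff hb0, sub_eq_iff_eq_add, mul_comm, hbw, add_comm]
    rw [coeff_single, coeff_single]
    by_cases haw : a - v = w
    · rw [if_pos (this.2 haw), if_pos haw]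
    · rw [if_neg (this.not.2 haw), if_neg haw]
  have hscal : rootPowerSeries q hq (PowerSeries.constantCoeff g • h')
      = PowerSeries.constantCoeff g • rootPowerSeries q hq h' := by
    refine puiseux_ext fun a => ?_
    rw [smul_puiseux_coeff]
    by_cases ha : ∃ n : ℕ, a = (n : ℚ) / q
    · obtain ⟨n, rfl⟩ := ha
      rw [rootPowerSeries_coeff, rootPowerSeries_coeff, PowerSeries.coeff_smul, smul_eq_mul]
    · push Not at ha
      rw [rootPowerSeries_coeff_eq_zero q hq _ _ ha, rootPowerSeries_coeff_eq_zero q hq _ _ ha,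
        mul_zero]
  refine ⟨Units.mk0 _ hv, puiseuxMonomial w * rootPowerSeries q hq h, ?_, ?_⟩
  · intro h0
    have h1 := puiseuxMonomial_mul_coeff w (rootPowerSeries q hq h) w
    have h2 := rootPowerSeries_coeff q hq h 0
    rw [Nat.cast_zero, zero_div, PowerSeries.coeff_zero_eq_constantCoeff_apply, hh] at h2
    rw [h0, sub_self, h2] at h1
    exact zero_ne_one h1
  · rw [map_mul, hMh, hMw, Units.val_mk0, ← hg0, ← mul_smul_comm, ← hscal, hh3, map_mul]
    conv_rhs => rw [hug]
    ring

end FirstOrder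

/-! ### Riccati solutions and projective spaces -/

section Classes

variable (b : ℕ) [b.AtLeastTwo] {K : Type*} [Field K] {r : ℕ} (l : Fin (r + 1) → K[X])
  {E : Type*} [Field E] [Algebra K E]

theorem isMahlerQuotient_expTimes {lam : Eˣ} {p u : Puiseux E} (hp : p ≠ 0) :
    IsMahlerQuotient b u (expTimes lam p) ↔ (lam : E) • mahler b E p = u * p := by
  have hunit : IsUnit (expTimes lam p) := by
    refine IsUnit.of_mul_eq_one (expTimes lam⁻¹ p⁻¹) ?_
    rw [MonoidAlgebra.single_mul_single, mul_inv_cancel, mul_inv_cancel₀ hp, MonoidAlgebra.one_def]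
  rw [IsMahlerQuotient, mahlerD_expTimes, MonoidAlgebra.smul_single, smul_eq_mul]
  exact ⟨fun h => MonoidAlgebra.single_right_inj.1 h.2, fun h => ⟨hunit, by rw [h]⟩⟩

theorem mem_hypSolutions {lam : Eˣ} {y : GenSeries E} :
    y ∈ hypSolutions b l E lam ↔
      ∃ p : Puiseux E, y = expTimes lam p ∧ twistedOp b l (lam : E) p = 0 := by
  constructor
  · rintro ⟨⟨p, rfl⟩, -, h⟩
    exact ⟨p, rfl, (linOp_expTimes_eq_zero b l).1 h⟩
  · rintro ⟨p, rfl, h⟩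
    exact ⟨⟨p, rfl⟩, isHypergeometric_expTimes b lam p, (linOp_expTimes_eq_zero b l).2 h⟩

theorem mem_riccatiClass {lam : Eˣ} {u : Puiseux E} :
    u ∈ riccatiClass b l E lam ↔
      ∃ p : Puiseux E, p ≠ 0 ∧ twistedOp b l (lam : E) p = 0 ∧
        (lam : E) • mahler b E p = u * p := by
  constructor
  · rintro ⟨y, hy, hy0, hu⟩
    obtain ⟨p, rfl, hp⟩ := (mem_hypSolutions b l).1 hy
    have hp0 : p ≠ 0 := fun h => hy0 (expTimes_eq_zero.2 h)
    exact ⟨p, hp0, hp, (isMahlerQuotient_expTimes b hp0).1 hu⟩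
  · rintro ⟨p, hp0, hp, hu⟩
    exact ⟨expTimes lam p, (mem_hypSolutions b l).2 ⟨p, rfl, hp⟩,
      fun h => hp0 (expTimes_eq_zero.1 h), (isMahlerQuotient_expTimes b hp0).2 hu⟩

/-- The product `u (M u) ⋯ (M^{k-1} u)` telescopes, so the Riccati expression times `p` is the
twisted operator applied to `p`. -/
theorem mem_riccatiSolutions_iff {lam : Eˣ} {p u : Puiseux E} (hp : p ≠ 0)
    (hu : (lam : E) • mahler b E p = u * p) :
    u ∈ riccatiSolutions b l E ↔ twistedOp b l (lam : E) p = 0 := by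
  have hprod : ∀ k : ℕ, (lam : E) ^ k • (mahler b E)^[k] p
      = (∏ i ∈ Finset.range k, (mahler b E)^[i] u) * p := by
    intro k
    induction k with
    | zero => simp
    | succ k ih =>
      have hit : (mahler b E)^[k] ((lam : E) • mahler b E p)
          = (lam : E) • (mahler b E)^[k] (mahler b E p) := by
        generalize mahler b E p = w
        clear ih hu
        induction k generalizing w with
        | zero => rfl
        | succ k ih => rw [Function.iterate_succ_apply, map_smul, ih, Function.iterate_succ_apply]
      rw [Finset.prod_range_succ, mul_right_comm, ← ih, pow_succ, mul_smul,
        Function.iterate_succ_apply, ← hit, hu, iterate_map_mul, smul_mul_assoc, mul_comm]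
  have : twistedOp b l (lam : E) p = (∑ k : Fin (r + 1), polyToPuiseux K E (l k) *
      ∏ i ∈ Finset.range k, (mahler b E)^[i] u) * p := by
    rw [twistedOp, Finset.sum_mul]
    exact Finset.sum_congr rfl fun k _ => by rw [hprod, mul_assoc]
  rw [this, mul_eq_zero, or_iff_left hp]
  exact Iff.rfl

/-- `M` preserves leading coefficients, so only the factor `λ` survives in the quotient. -/
theorem leadingCoeff_quotient {lam : Eˣ} {p u : Puiseux E} (hp : p ≠ 0)
    (hu : (lam : E) • mahler b E p = u * p) : (u : HahnSeries ℚ E).leadingCoeff = lam := by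
  have hb0 : (0 : ℚ) < b := by
    have := Nat.AtLeastTwo.prop (n := b)
    exact_mod_cast (by omega : 0 < b)
  obtain ⟨v, hv, hlc, hmin⟩ := puiseux_exists_coeff_ne_zero hp
  have hp0 : (p : HahnSeries ℚ E).leadingCoeff ≠ 0 := by rwa [hlc]
  have hbv : (((lam : E) • mahler b E p : Puiseux E) : HahnSeries ℚ E).coeff (b * v)
      = lam * (p : HahnSeries ℚ E).coeff v := by
    rw [smul_puiseux_coeff, mahler_coeff, mul_div_cancel_left₀ _ hb0.ne']
  have h := leadingCoeff_eq_coeff (p := (lam : E) • mahler b E p) (v := b * v)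
    (by rw [hbv]; exact mul_ne_zero lam.ne_zero hv) (by
      intro a ha
      rw [smul_puiseux_coeff, mahler_coeff] at ha
      have := hmin _ (right_ne_zero_of_mul ha)
      rwa [le_div_iff₀ hb0, mul_comm] at this)
  rw [hbv, ← hlc, hu, MulMemClass.coe_mul, HahnSeries.leadingCoeff_mul] at h
  exact mul_right_cancel₀ hp0 h

variable {l} in
theorem quotient_mem_ramifiedLaurent (h0 : l 0 ≠ 0) {lam : Eˣ} {p u : Puiseux E} (hp : p ≠ 0)
    (hsol : twistedOp b l (lam : E) p = 0) (hu : (lam : E) • mahler b E p = u * p) :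
    (u : HahnSeries ℚ E) ∈
      ramifiedLaurent E (ramBound b l (lam : E)) (ramBound_pos b l (lam : E)) := by
  have hb0 : (b : ℚ) ≠ 0 := by
    have := Nat.AtLeastTwo.prop (n := b)
    exact_mod_cast (by omega : b ≠ 0)
  have hmem := mem_ramifiedLaurent_of_twistedOp_eq_zero b h0 lam.ne_zero hsol
  have hMmem : ((mahler b E p : Puiseux E) : HahnSeries ℚ E) ∈
      ramifiedLaurent E (ramBound b l (lam : E)) (ramBound_pos b l (lam : E)) := by
    rw [mem_ramifiedLaurent_iff] at hmem ⊢
    intro a ha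
    rw [mahler_coeff] at ha
    obtain ⟨n, hn⟩ := hmem _ ha
    refine ⟨b * n, ?_⟩
    rw [div_eq_iff hb0] at hn
    rw [hn]
    push_cast
    ring
  have hu' : u = (lam : E) • mahler b E p * p⁻¹ := by
    rw [hu, mul_inv_cancel_right₀ hp]
  have hcoe : (u : HahnSeries ℚ E)
      = ((lam : E) • ((mahler b E p : Puiseux E) : HahnSeries ℚ E)) * (p : HahnSeries ℚ E)⁻¹ :=
    congrArg Subtype.val hu'
  rw [hcoe]
  exact mul_mem ((ramifiedLaurent E _ _).smul_mem hMmem) (inv_mem hmem)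

theorem riccatiSolutions_ne_zero {l : Fin (r + 1) → K[X]} (h0 : polyToPuiseux K E (l 0) ≠ 0)
    {u : Puiseux E} (hu : u ∈ riccatiSolutions b l E) : u ≠ 0 := by
  rintro rfl
  have h : ∑ k : Fin (r + 1), polyToPuiseux K E (l k) *
    ∏ i ∈ Finset.range k, (mahler b E)^[i] (0 : Puiseux E) = 0 := hu
  rw [Finset.sum_eq_single 0] at h
  · simp only [Fin.val_zero, Finset.range_zero, Finset.prod_empty, mul_one] at h
    exact h0 h
  · intro k _ hk
    refine mul_eq_zero_of_right _ (Finset.prod_eq_zero (i := 0) ?_ rfl)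
    exact Finset.mem_range.2 (Nat.pos_of_ne_zero fun h => hk (Fin.ext h))
  · intro h
    exact absurd (Finset.mem_univ _) h

/-- The Puiseux factor `p` of a solution `e_λ p`. -/
def hypFactor (lam : Eˣ) : hypSolutions b l E lam →ₗ[E] Puiseux E where
  toFun y := (y : GenSeries E).coeff lam
  map_add' _ _ := rfl
  map_smul' _ _ := rfl

theorem hypFactor_spec {lam : Eˣ} (y : hypSolutions b l E lam) :
    (y : GenSeries E) = expTimes lam (hypFactor b l lam y) ∧
      twistedOp b l (lam : E) (hypFactor b l lam y) = 0 := by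
  obtain ⟨p, hy, hp⟩ := (mem_hypSolutions b l).1 y.2
  have : hypFactor b l lam y = p := by
    change (y : GenSeries E).coeff lam = p
    rw [hy]
    simp
  rw [this]
  exact ⟨hy, hp⟩

theorem hypFactor_eq_zero {lam : Eˣ} {y : hypSolutions b l E lam} :
    hypFactor b l lam y = 0 ↔ y = 0 := by
  constructor
  · intro h
    refine Subtype.ext ?_
    rw [(hypFactor_spec b l y).1, h]
    exact expTimes_eq_zero.2 rfl
  · rintro rfl
    exact map_zero _

-- Independent families for distinct `λ` can be pooled, since the hypothesis of
-- `card_le_of_independent` only concerns relations within a single `λ`.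
variable {l} in
theorem sum_finrank_le (h0 : l 0 ≠ 0) (hr : l (Fin.last r) ≠ 0) (s : Finset Eˣ) {n : Eˣ → ℕ}
    (v : ∀ lam : Eˣ, Fin (n lam) → hypSolutions b l E lam)
    (hv : ∀ lam, LinearIndependent E (v lam)) : ∑ lam ∈ s, n lam ≤ r := by
  classical
  have hsol : ∀ x : Σ lam : s, Fin (n lam),
      twistedOp b l ((x.1 : Eˣ) : E) (hypFactor b l (x.1 : Eˣ) (v x.1 x.2)) = 0 := by
    rintro ⟨⟨lam, hlam⟩, i⟩
    exact (hypFactor_spec b l (v lam i)).2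
  have h := card_le_of_independent b h0 hr (ι := Σ lam : s, Fin (n lam))
    (fun x => (x.1 : Eˣ)) (fun x => hypFactor b l (x.1 : Eˣ) (v x.1 x.2)) hsol (by
      intro c μ hμ hc
      by_contra hne
      obtain ⟨⟨lam, i⟩, hi⟩ := Function.ne_iff.1 hne
      rw [Fintype.sum_sigma, Finset.sum_eq_single lam] at hc
      · have hz : hypFactor b l (lam : Eˣ) (∑ j, c ⟨lam, j⟩ • v lam j) = 0 := by
          rw [map_sum, ← hc]
          exact Finset.sum_congr rfl fun j _ => map_smul _ _ _
        exact hi (Fintype.linearIndependent_iff.1 (hv lam) _ ((hypFactor_eq_zero b l).1 hz) i)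
      · intro lam' _ hlam'
        refine Finset.sum_eq_zero fun j _ => ?_
        have : c ⟨lam', j⟩ = 0 := by
          by_contra hj
          exact hlam' (Subtype.ext ((hμ _ hj).trans (hμ _ hi).symm))
        rw [this, zero_smul]
      · intro h
        exact absurd (Finset.mem_univ _) h)
  rw [Fintype.card_sigma] at h
  simp only [Fintype.card_fin] at h
  rwa [Finset.sum_coe_sort s n] at h

variable {l} in
theorem finite_hypSolutions (h0 : l 0 ≠ 0) (hr : l (Fin.last r) ≠ 0) (lam : Eˣ) :
    Module.Finite E (hypSolutions b l E lam) := by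
  classical
  refine Module.rank_lt_aleph0_iff.1 (lt_of_le_of_lt
    (rank_le (R := E) (n := r) fun s hs => ?_) (Cardinal.natCast_lt_aleph0 (n := r)))
  have h := card_le_of_independent b h0 hr (ι := s) (fun _ => lam)
    (fun y => hypFactor b l lam y) (fun y => (hypFactor_spec b l _).2) (by
      intro c μ _ hc
      simp only [← map_smul, ← map_sum] at hc
      exact funext (Fintype.linearIndependent_iff.1 hs c ((hypFactor_eq_zero b l).1 hc)))
  simpa using h

/-- Two solutions with equal quotients have a ratio fixed by `M`, hence constant. Since `M` fixes
constants, `λ M p` and `p` are both linear in the coordinates, so the map is rational of degree 1.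
-/
theorem exists_quotient_map (lam : Eˣ) :
    ∃ φ : Projectivization E (hypSolutions b l E lam) → Puiseux E,
      Function.Injective φ ∧ Set.range φ = riccatiClass b l E lam ∧
      (∀ (y : hypSolutions b l E lam) (hy : y ≠ 0),
        IsMahlerQuotient b (φ (Projectivization.mk E y hy)) (y : GenSeries E)) ∧
      IsRationalOnProj φ := by
  let ψ : hypSolutions b l E lam → Puiseux E := fun y =>
    (lam : E) • mahler b E (hypFactor b l lam y) / hypFactor b l lam y
  have hψ : ∀ (c : E) (y : hypSolutions b l E lam), c ≠ 0 → ψ (c • y) = ψ y := by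
    intro c y hc
    simp only [ψ, map_smul]
    rw [smul_comm]
    simp only [Algebra.smul_def c]
    exact mul_div_mul_left _ _ ((_root_.map_ne_zero _).2 hc)
  let φ : Projectivization E (hypSolutions b l E lam) → Puiseux E :=
    Projectivization.lift (fun y => ψ y) (by
      rintro ⟨x, hx⟩ ⟨y, hy⟩ t ht
      simp only at ht
      have ht0 : t ≠ 0 := by
        rintro rfl
        exact hx (by rw [ht, zero_smul])
      simp only [ht]
      exact hψ t y ht0)
  have hφ : ∀ (y : hypSolutions b l E lam) (hy : y ≠ 0), φ (Projectivization.mk E y hy) = ψ y :=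
    fun y hy => rfl
  have hne : ∀ y : hypSolutions b l E lam, y ≠ 0 → hypFactor b l lam y ≠ 0 :=
    fun y hy => (hypFactor_eq_zero b l).not.2 hy
  have hquot : ∀ y : hypSolutions b l E lam, y ≠ 0 →
      (lam : E) • mahler b E (hypFactor b l lam y) = ψ y * hypFactor b l lam y :=
    fun y hy => (div_mul_cancel₀ _ (hne y hy)).symm
  have hmq : ∀ y : hypSolutions b l E lam, y ≠ 0 → IsMahlerQuotient b (ψ y) (y : GenSeries E) := by
    intro y hy
    rw [(hypFactor_spec b l y).1, isMahlerQuotient_expTimes b (hne y hy)]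
    exact hquot y hy
  refine ⟨φ, ?_, ?_, fun y hy => hmq y hy, ?_⟩
  · intro P Q
    induction P using Projectivization.ind with | h x hx => ?_
    induction Q using Projectivization.ind with | h y hy => ?_
    rw [hφ, hφ]
    intro h
    have h1 := hquot x hx
    have h2 := hquot y hy
    set p := hypFactor b l lam x with hp
    set q := hypFactor b l lam y with hq
    have hp0 : p ≠ 0 := hne x hx
    have hq0 : q ≠ 0 := hne y hy
    rw [h] at h1
    have hMq : mahler b E q ≠ 0 := (_root_.map_ne_zero _).2 hq0
    have hmul : mahler b E p * q = mahler b E q * p := by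
      have h3 : (lam : E) • (mahler b E p * q) = (lam : E) • (mahler b E q * p) := by
        rw [← smul_mul_assoc, ← smul_mul_assoc, h1, h2]
        ring
      have h4 := congrArg (fun w => (lam : E)⁻¹ • w) h3
      rwa [inv_smul_smul₀ lam.ne_zero, inv_smul_smul₀ lam.ne_zero] at h4
    have hfix : mahler b E (p / q) = (1 : E) • (p / q) := by
      rw [one_smul, map_div₀, div_eq_div_iff hMq hq0, hmul, mul_comm]
    obtain ⟨-, e, he⟩ := mahler_eigenvector b one_ne_zero (div_ne_zero hp0 hq0) hfix
    have hpe : p = e • q := by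
      rw [Algebra.smul_def, ← he, div_mul_cancel₀ _ hq0]
    rw [Projectivization.mk_eq_mk_iff']
    refine ⟨e, ?_⟩
    have : hypFactor b l lam (e • y - x) = 0 := by
      rw [map_sub, map_smul, ← hq, ← hp, hpe, sub_self]
    exact sub_eq_zero.1 ((hypFactor_eq_zero b l).1 this)
  · ext u
    constructor
    · rintro ⟨P, rfl⟩
      induction P using Projectivization.ind with | h x hx => ?_
      exact ⟨x, x.2, fun h => hx (Subtype.ext h), hmq x hx⟩
    · rintro ⟨y, hy, hy0, -, hu⟩
      have hy0' : (⟨y, hy⟩ : hypSolutions b l E lam) ≠ 0 := fun h => hy0 (congrArg Subtype.val h)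
      refine ⟨Projectivization.mk E ⟨y, hy⟩ hy0', ?_⟩
      rw [hφ]
      obtain ⟨hunit, hq⟩ := hmq _ hy0'
      rw [hu, ← algebraMap_smul (GenSeries E) u, ← algebraMap_smul (GenSeries E) (ψ _),
        smul_eq_mul, smul_eq_mul] at hq
      have := hunit.mul_right_cancel hq
      exact ((algebraMap (Puiseux E) (GenSeries E)).injective this).symm
  · intro n v
    let p : Fin n → Puiseux E := fun i => hypFactor b l lam (v i)
    refine ⟨1, ∑ i, MvPolynomial.C ((lam : E) • mahler b E (p i)) * MvPolynomial.X i,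
      ∑ i, MvPolynomial.C (p i) * MvPolynomial.X i, ?_, ?_, ?_⟩
    · exact MvPolynomial.IsHomogeneous.sum _ _ _ fun i _ =>
        MvPolynomial.isHomogeneous_C_mul_X _ i
    · exact MvPolynomial.IsHomogeneous.sum _ _ _ fun i _ =>
        MvPolynomial.isHomogeneous_C_mul_X _ i
    · intro c hc
      have hB : hypFactor b l lam (∑ i, c i • v i)
          = ∑ i, p i * algebraMap E (Puiseux E) (c i) := by
        rw [map_sum]
        refine Finset.sum_congr rfl fun i _ => ?_
        rw [map_smul, Algebra.smul_def, mul_comm]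
      have hA : (lam : E) • mahler b E (hypFactor b l lam (∑ i, c i • v i))
          = ∑ i, (lam : E) • mahler b E (p i) * algebraMap E (Puiseux E) (c i) := by
        rw [hB, map_sum, Finset.smul_sum]
        refine Finset.sum_congr rfl fun i _ => ?_
        rw [map_mul, AlgHom.commutes, smul_mul_assoc]
      simp only [map_sum, map_mul, MvPolynomial.eval_C, MvPolynomial.eval_X]
      rw [← hB, ← hA]
      exact ⟨hne _ hc, hφ _ hc⟩

end Classes

/-- The description of the solutions of the Riccati equation over `E` in terms of the set of
the `λ` such that `L y = 0` has a nonzero solution in `e_λ Puiseux(E)`. -/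
theorem riccati_description (b : ℕ) [b.AtLeastTwo] {K : Type*} [Field K] {r : ℕ}
    {l : Fin (r + 1) → K[X]} (h0 : l 0 ≠ 0) (hr : l (Fin.last r) ≠ 0)
    {E : Type*} [Field E] [Algebra K E] {Λ : Set Eˣ}
    (hΛ : ∀ lam : Eˣ, lam ∈ Λ ↔ ∃ p : Puiseux E, p ≠ 0 ∧ twistedOp b l (lam : E) p = 0) :
    riccatiSolutions b l E =
        ⋃ lam ∈ Λ, riccatiClass b l E lam ∧
    (Λ).PairwiseDisjoint
        (fun lam => riccatiClass b l E lam) ∧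
    (∀ lam ∈ Λ,
      (∀ u ∈ riccatiClass b l E lam,
        (u : HahnSeries ℚ E) ∈
            ramifiedLaurent E (ramBound b l (lam : E))
              (ramBound_pos b l (lam : E)) ∧
          (u : HahnSeries ℚ E).leadingCoeff = (lam : E)) ∧
      Module.Finite E (hypSolutions b l E lam) ∧
      Nontrivial (hypSolutions b l E lam) ∧
      ∃ φ : Projectivization E (hypSolutions b l E lam) →
          Puiseux E,
        Function.Injective φ ∧
        Set.range φ = riccatiClass b l E lam ∧
        (∀ (y : hypSolutions b l E lam) (hy : y ≠ 0),
          IsMahlerQuotient b (φ (Projectivization.mk E y hy))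
            (y : GenSeries E)) ∧
        IsRationalOnProj φ) ∧
    ∃ hfin : (Λ).Finite,
      ∑ lam ∈ hfin.toFinset,
          ((Module.finrank E (hypSolutions b l E lam) : ℤ) - 1) ≤
        (r : ℤ) - hfin.toFinset.card := by
  have hfinite : ∀ lam, Module.Finite E (hypSolutions b l E lam) :=
    fun lam => finite_hypSolutions b h0 hr lam
  have hfree : ∀ lam, Module.Free E (hypSolutions b l E lam) :=
    fun lam => Module.Free.of_divisionRing ..
  have hnontriv : ∀ lam ∈ Λ, Nontrivial (hypSolutions b l E lam) := by
    intro lam hlam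
    obtain ⟨p, hp0, hp⟩ := (hΛ _).1 hlam
    exact ⟨⟨⟨expTimes lam p, (mem_hypSolutions b l).2 ⟨p, rfl, hp⟩⟩, 0,
      fun h => hp0 (expTimes_eq_zero.1 (congrArg Subtype.val h))⟩⟩
  have hsum : ∀ s : Finset Eˣ, ∑ lam ∈ s, Module.finrank E (hypSolutions b l E lam) ≤ r :=
    fun s => sum_finrank_le b h0 hr s (fun lam => Module.finBasis E (hypSolutions b l E lam))
      fun lam => (Module.finBasis E _).linearIndependent
  refine ⟨?_, ?_, ?_, ?_⟩
  · ext u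
    simp only [Set.mem_iUnion, exists_prop]
    constructor
    · intro hu
      obtain ⟨lam, p, hp0, hup⟩ := exists_mahler_quotient b
        (riccatiSolutions_ne_zero b (polyToPuiseux_ne_zero h0) hu)
      have hp := (mem_riccatiSolutions_iff b l hp0 hup).1 hu
      exact ⟨lam, (hΛ _).2 ⟨p, hp0, hp⟩,
        (mem_riccatiClass b l).2 ⟨p, hp0, hp, hup⟩⟩
    · rintro ⟨lam, -, hu⟩
      obtain ⟨p, hp0, hp, hup⟩ := (mem_riccatiClass b l).1 hu
      exact (mem_riccatiSolutions_iff b l hp0 hup).2 hp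
  · intro lam _ mu _ hne
    refine Set.disjoint_left.2 fun u hu hu' => hne (Units.ext ?_)
    obtain ⟨p, hp0, -, hup⟩ := (mem_riccatiClass b l).1 hu
    obtain ⟨q, hq0, -, huq⟩ := (mem_riccatiClass b l).1 hu'
    rw [← leadingCoeff_quotient b hp0 hup, ← leadingCoeff_quotient b hq0 huq]
  · intro lam hlam
    refine ⟨fun u hu => ?_, hfinite lam, hnontriv lam hlam, exists_quotient_map b l lam⟩
    obtain ⟨p, hp0, hp, hup⟩ := (mem_riccatiClass b l).1 hu
    exact ⟨quotient_mem_ramifiedLaurent b h0 hp0 hp hup, leadingCoeff_quotient b hp0 hup⟩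
  -- Each `λ` contributes dimension at least 1, so `r + 1` of them would exceed the bound `r`.
  · have hfin : (Λ).Finite := by
      by_contra hinf
      obtain ⟨s, hs, hcard⟩ := Set.Infinite.exists_subset_card_eq hinf (r + 1)
      have h1 : s.card ≤ ∑ lam ∈ s, Module.finrank E (hypSolutions b l E lam) := by
        rw [Finset.card_eq_sum_ones]
        refine Finset.sum_le_sum fun lam hlam => ?_
        have := hnontriv lam (hs hlam)
        exact (Module.finrank_pos_iff_of_free E (hypSolutions b l E lam)).2 this
      have h2 := hsum s
      omega
    refine ⟨hfin, ?_⟩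
    rw [Finset.sum_sub_distrib, Finset.sum_const, nsmul_one]
    have := hsum hfin.toFinset
    have h3 : ∑ lam ∈ hfin.toFinset, (Module.finrank E (hypSolutions b l E lam) : ℤ) ≤ r := by
      exact_mod_cast this
    linarith

/-- `Λ'` is defined over the algebraic closure; solutions pass between `F` and the closure by
descent and extension of scalars. Membership in `Λ` is automatic by `exists_admissible_edge`. -/
theorem mem_charRootsIn (b : ℕ) [b.AtLeastTwo] {K Kbar : Type*} [Field K] [Field Kbar]
    [Algebra K Kbar] (F : IntermediateField K Kbar) {r : ℕ} {l : Fin (r + 1) → K[X]}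
    (h0 : l 0 ≠ 0) (lam : (↥F)ˣ) :
    lam ∈ charRootsIn b l F ↔ ∃ p : Puiseux F, p ≠ 0 ∧ twistedOp b l (lam : F) p = 0 := by
  have h := fun p : Puiseux Kbar =>
    linOp_expTimes_eq_zero b l (lam := Units.map (algebraMap F Kbar : F →* Kbar) lam) (p := p)
  have hcoe : ((Units.map (algebraMap F Kbar : F →* Kbar) lam : Kbarˣ) : Kbar)
      = algebraMap F Kbar (lam : F) := rfl
  have hne : algebraMap F Kbar (lam : F) ≠ 0 :=
    hcoe ▸ (Units.map (algebraMap F Kbar : F →* Kbar) lam).ne_zero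
  rw [charRootsIn, Set.mem_ofPred_eq, charRoots', Set.mem_ofPred_eq, hcoe]
  simp only [h, ne_eq, expTimes_eq_zero, hcoe]
  constructor
  · rintro ⟨-, p, hp0, hp⟩
    exact exists_solution_descend b hp0 hp
  · rintro ⟨p, hp0, hp⟩
    obtain ⟨p', hp0', hp'⟩ := exists_solution_extend (E' := Kbar) b hp0 hp
    obtain ⟨v, hv, -, hmin⟩ := puiseux_exists_coeff_ne_zero hp0'
    obtain ⟨e, he, hadm, -⟩ := exists_admissible_edge b h0 hne hp' hv hmin
    exact ⟨⟨e, he, hadm⟩, p', hp0', hp'⟩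

end MahlerRiccati

end

theorem mainTheorem5 {K Kbar : Type*} [Field K] [CharZero K] [Field Kbar] [Algebra K Kbar]
    [IsAlgClosure K Kbar] (F : IntermediateField K Kbar) (b : ℕ) [b.AtLeastTwo] (r : ℕ)
    (l : Fin (r + 1) → Polynomial K) (h0 : l 0 ≠ 0) (hr : l (Fin.last r) ≠ 0) :
    MahlerRiccati.riccatiSolutions b l F =
        ⋃ lam ∈ MahlerRiccati.charRootsIn b l F, MahlerRiccati.riccatiClass b l F lam ∧
    (MahlerRiccati.charRootsIn b l F).PairwiseDisjoint
        (fun lam => MahlerRiccati.riccatiClass b l F lam) ∧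
    (∀ lam ∈ MahlerRiccati.charRootsIn b l F,
      (∀ u ∈ MahlerRiccati.riccatiClass b l F lam,
        (u : HahnSeries ℚ F) ∈
            MahlerRiccati.ramifiedLaurent F (MahlerRiccati.ramBound b l (lam : F))
              (MahlerRiccati.ramBound_pos b l (lam : F)) ∧
          (u : HahnSeries ℚ F).leadingCoeff = (lam : F)) ∧
      Module.Finite F (MahlerRiccati.hypSolutions b l F lam) ∧
      Nontrivial (MahlerRiccati.hypSolutions b l F lam) ∧
      ∃ φ : Projectivization F (MahlerRiccati.hypSolutions b l F lam) →
          MahlerRiccati.Puiseux F,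
        Function.Injective φ ∧
        Set.range φ = MahlerRiccati.riccatiClass b l F lam ∧
        (∀ (y : MahlerRiccati.hypSolutions b l F lam) (hy : y ≠ 0),
          MahlerRiccati.IsMahlerQuotient b (φ (Projectivization.mk F y hy))
            (y : MahlerRiccati.GenSeries F)) ∧
        MahlerRiccati.IsRationalOnProj φ) ∧
    ∃ hfin : (MahlerRiccati.charRootsIn b l F).Finite,
      ∑ lam ∈ hfin.toFinset,
          ((Module.finrank F (MahlerRiccati.hypSolutions b l F lam) : ℤ) - 1) ≤
        (r : ℤ) - hfin.toFinset.card := by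
  exact MahlerRiccati.riccati_description b h0 hr (MahlerRiccati.mem_charRootsIn b F h0)
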